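/- Let $m\ge 2$, let $(|e_j\rangle)_{j=1}^m$ be an orthonormal basis of an $m$-dimensional complex Hilbert space, $|e_0\rangle=\frac1{\sqrt m}\sum_j|e_j\rangle$, and let $0\le r_0\le r_1$ with $r_0+(m-1)r_1=1$. The (obtuse) quantum pyramid is the ensemble $\mathcal E$ of the $m$ equiprobable pure states $|\psi_j\rangle\langle\psi_j|$, where $$|\psi_j\rangle=\sqrt{mr_1}\,|e_j\rangle+(\sqrt{r_0}-\sqrt{r_1})|e_0\rangle=a|e_j\rangle+b\sum_{k\ne j}|e_k\rangle,\qquad b=\frac{\sqrt{r_0}-\sqrt{r_1}}{\sqrt m},\quad a=\sqrt{mr_1}+b.$$ (The endpoint cases are the flat pyramid $r_0=0$ and the orthonormal one $r_0=r_1$.) Put $p=a^2$; then $p\in[\frac{m-1}m,1]$. An observable is a finite family of positive operators $M_k$ with $\sum_kM_k=I$; $I(\mathcal E,M)$ is the Shannon mutual information (binary logarithm, $0\log 0=0$) of the joint distribution $p_{jk}=\frac1m\langle\psi_j|M_k|\psi_j\rangle$; the accessible information is $A(\mathcal E)=\sup_M I(\mathcal E,M)$ over all observables, and $M$ is information-optimal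 if it attains the supremum. Let $$g_m(\tau)=\log\frac{m(m-1+\tau^2)}2-\frac{m-1+\tau}m\log(m-1+\tau)^2-\frac{1-\tau}m\log(1-\tau)^2 ,$$ and let $\tau_o(m)$ be the greatest zero of $g_m$ in $(-\infty,1]$ and $p(m)=\Big[1+(m-1)\big(1-\frac m{1-\tau_o(m)}\big)^{-2}\Big]^{-1}$. For $t\ge1$ let $\mathcal M(t)$ be the observable with the $m+\frac{m(m-1)}2$ components $$M_k=t^{-2}|\tilde e_k\rangle\langle\tilde e_k|,\ \ |\tilde e_k\rangle=|e_k\rangle+\tfrac{t-1}{\sqrt m}|e_0\rangle\ (1\le k\le m);\qquad M_{rs}=\tfrac2m(1-t^{-2})|rs\rangle\langle rs|,\ \ |rs\rangle=\tfrac1{\sqrt2}(|e_r\rangle-|e_s\rangle)\ (1\le r<s\le m).$$ Then: 1. The greatest zero $\tau_o(m)$ exists. For $m\le6$ it is the unique zero of $g_m$ in $[0,1]$; for $m\ge7$ it is negative and $p(m)<\frac{m-1}m$. 2. The following observables are information-optimal: $\mathcal M(1)$ (the square-root measurement) if $m\ge7$; $\mathcal M(1)$ if $m\le6$ and $p\ge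 p(m)$; and $\mathcal M(t)$ with $t=\sqrt{r_1/r_0}\;\tau_o(m)\ge1$ if $m\le6$, $r_0>0$ and $p\le p(m)$. 3. $A(\mathcal E)$ is finite. If $p\in[\max\{\frac{m-1}m,p(m)\},1]$, then $$A(\mathcal E)=\log m+a^2\log a^2+(m-1)b^2\log b^2 .$$ If $m\le6$ and $p\in[\frac{m-1}m,p(m)]$, then $$A(\mathcal E)=\log\frac m2-r_0\big(\tau_o(m)^{-1}-1\big)\log\frac{2(\tau_o(m)-1)^2}{m(m-1+\tau_o(m)^2)}=\log\frac m2-r_0\,m\,\tilde\mu_0(p(m)),$$ where $$\tilde\mu_0(p)=\frac{\sqrt{\frac{p(1-p)}{m-1}}\big(\log p-\log\frac{1-p}{m-1}\big)}{\big((m-1)\sqrt{\frac{1-p}{m-1}}-\sqrt p\big)\big(\sqrt p+\sqrt{\frac{1-p}{m-1}}\big)}$$ (for $m=2$ the last case occurs only for $r_0=0$, where $\tau_o(2)=0$ and the terms multiplied by $r_0$ are read as $0$). -/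

import Mathlib

noncomputable section

namespace QPyramid

/-! ### Ensembles, observables, accessible information -/

/-- A finite ensemble `{π_j, ρ_j}` of quantum states (density operators) on a finite-dimensional
Hilbert space. -/
structure Ensemble (ι : Type*) [Fintype ι] (H : Type*) [NormedAddCommGroup H]
    [InnerProductSpace ℂ H] [FiniteDimensional ℂ H] where
  prob : ι → ℝ
  state : ι → H →L[ℂ] H
  prob_nonneg : ∀ j, 0 ≤ prob j
  prob_sum : ∑ j, prob j = 1
  state_pos : ∀ j, (state j).IsPositive
  state_trace : ∀ j, LinearMap.trace ℂ H (state j : H →ₗ[ℂ] H) = 1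

/-- An observable with outcome set `κ`: positive operators summing to the unit operator. -/
def IsObservable {κ : Type*} [Fintype κ] {H : Type*} [NormedAddCommGroup H]
    [InnerProductSpace ℂ H] (M : κ → H →L[ℂ] H) : Prop :=
  (∀ k, (M k).IsPositive) ∧ ∑ k, M k = ContinuousLinearMap.id ℂ H

section
variable {ι : Type*} [Fintype ι] {κ : Type*} [Fintype κ] {H : Type*} [NormedAddCommGroup H]
  [InnerProductSpace ℂ H] [FiniteDimensional ℂ H]

/-- Joint distribution `p_{jk} = π_j Tr ρ_j M_k` of input `j` and output `k`. -/
def jointProb (E : Ensemble ι H) (M : κ → H →L[ℂ] H) (j : ι) (k : κ) : ℝ :=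
  E.prob j * (LinearMap.trace ℂ H ((E.state j ∘L M k : H →L[ℂ] H) : H →ₗ[ℂ] H)).re

/-- Output distribution `p_k = ∑_j p_{jk}`. -/
def outcomeProb (E : Ensemble ι H) (M : κ → H →L[ℂ] H) (k : κ) : ℝ :=
  ∑ j, jointProb E M j k

/-- Shannon mutual information (binary logarithm) between input and output. A term with
`p_{jk} = 0` is zero. -/
def mutualInfo (E : Ensemble ι H) (M : κ → H →L[ℂ] H) : ℝ :=
  ∑ j, ∑ k, jointProb E M j k *
    Real.logb 2 (jointProb E M j k / (E.prob j * outcomeProb E M k))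

/-- All values of the mutual information over observables with finitely many outcomes. -/
def infoValues (E : Ensemble ι H) : Set ℝ :=
  {I | ∃ (n : ℕ) (M : Fin n → H →L[ℂ] H), IsObservable M ∧ I = mutualInfo E M}

/-- Accessible information of an ensemble. -/
def accessibleInfo (E : Ensemble ι H) : ℝ := sSup (infoValues E)

/-- `M` is an information-optimal observable: it is an observable and no observable gives more
mutual information. -/
def IsInfoOptimal (E : Ensemble ι H) (M : κ → H →L[ℂ] H) : Prop :=
  IsObservable M ∧ ∀ (n : ℕ) (N : Fin n → H →L[ℂ] H), IsObservable N →
    mutualInfo E N ≤ mutualInfo E M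

end

/-! ### Quantum pyramids -/

section
variable {m : ℕ} {H : Type*} [NormedAddCommGroup H] [InnerProductSpace ℂ H]

/-- The axis vector `|e₀⟩ = m^{-1/2} ∑_j |e_j⟩`. -/
def axis (e : OrthonormalBasis (Fin m) ℂ H) : H :=
  ((1 / √(m : ℝ) : ℝ) : ℂ) • ∑ j, e j

/-- The edge vectors `|ψ_j⟩ = √(m r₁) |e_j⟩ + (√r₀ - √r₁) |e₀⟩` of the pyramid. -/
def edge (e : OrthonormalBasis (Fin m) ℂ H) (r0 r1 : ℝ) (j : Fin m) : H :=
  ((√(m * r1) : ℝ) : ℂ) • e j + ((√r0 - √r1 : ℝ) : ℂ) • axis e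

lemma inner_basis_axis (e : OrthonormalBasis (Fin m) ℂ H) (j : Fin m) :
    inner ℂ (e j) (axis e) = ((1 / √(m : ℝ) : ℝ) : ℂ) := by
  unfold axis
  rw [inner_smul_right, inner_sum, Finset.sum_eq_single j]
  · simp
  · intro i _ hi
    rw [e.inner_eq_ite, if_neg (Ne.symm hi)]
  · simp

lemma inner_axis_axis (e : OrthonormalBasis (Fin m) ℂ H) (hm : 2 ≤ m) :
    inner ℂ (axis e) (axis e) = (1 : ℂ) := by
  have h0 : (0 : ℝ) < m := by exact_mod_cast (by omega : 0 < m)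
  conv_lhs => arg 2; unfold axis
  rw [inner_smul_left, sum_inner]
  simp_rw [inner_basis_axis]
  rw [Finset.sum_const, Finset.card_univ, Fintype.card_fin, nsmul_eq_mul, Complex.conj_ofReal]
  norm_cast
  have h1 : √(m : ℝ) * √(m : ℝ) = m := Real.mul_self_sqrt h0.le
  have h2 : √(m : ℝ) ≠ 0 := (Real.sqrt_pos.2 h0).ne'
  field_simp
  nlinarith

lemma inner_edge_self (e : OrthonormalBasis (Fin m) ℂ H) {r0 r1 : ℝ} (hm : 2 ≤ m)
    (h0 : 0 ≤ r0) (h1 : 0 ≤ r1) (hs : r0 + (m - 1) * r1 = 1) (j : Fin m) :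
    inner ℂ (edge e r0 r1 j) (edge e r0 r1 j) = (1 : ℂ) := by
  have hm0 : (0 : ℝ) < m := by exact_mod_cast (by omega : 0 < m)
  have hax : inner ℂ (axis e) (e j) = ((1 / √(m : ℝ) : ℝ) : ℂ) := by
    rw [← inner_conj_symm, inner_basis_axis, Complex.conj_ofReal]
  unfold edge
  simp only [inner_add_left, inner_add_right, inner_smul_left, inner_smul_right,
    Complex.conj_ofReal, inner_basis_axis, hax, inner_axis_axis e hm]
  rw [e.inner_eq_ite, if_pos rfl]
  norm_cast
  have hq : √(m : ℝ) ≠ 0 := (Real.sqrt_pos.2 hm0).ne'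
  have h2 : √(m : ℝ) * √(m : ℝ) = m := Real.mul_self_sqrt hm0.le
  have h3 : √r0 * √r0 = r0 := Real.mul_self_sqrt h0
  have h4 : √r1 * √r1 = r1 := Real.mul_self_sqrt h1
  rw [Real.sqrt_mul hm0.le]
  field_simp
  linear_combination (√r1 * √r1) * h2 + h3 + ((m : ℝ) - 1) * h4 + hs

variable [FiniteDimensional ℂ H]

/-- The ensemble of the `m` equiprobable pure states `|ψ_j⟩⟨ψ_j|` of the pyramid. -/
def pyramidEnsemble (e : OrthonormalBasis (Fin m) ℂ H) (r0 r1 : ℝ) (hm : 2 ≤ m)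
    (h0 : 0 ≤ r0) (h1 : 0 ≤ r1) (hs : r0 + (m - 1) * r1 = 1) : Ensemble (Fin m) H where
  prob _ := 1 / (m : ℝ)
  state j := InnerProductSpace.rankOne ℂ (edge e r0 r1 j) (edge e r0 r1 j)
  prob_nonneg _ := by positivity
  prob_sum := by
    have : (m : ℝ) ≠ 0 := by exact_mod_cast (by omega : m ≠ 0)
    simp [this]
  state_pos _ := InnerProductSpace.isPositive_rankOne_self _
  state_trace j := by
    rw [InnerProductSpace.trace_rankOne]
    exact inner_edge_self e hm h0 h1 hs j


/-- `|ẽ_k⟩ = |e_k⟩ + (t - 1) m^{-1/2} |e₀⟩`. -/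
def etilde (e : OrthonormalBasis (Fin m) ℂ H) (t : ℝ) (k : Fin m) : H :=
  e k + (((t - 1) / √(m : ℝ) : ℝ) : ℂ) • axis e

/-- `|rs⟩ = 2^{-1/2} (|e_r⟩ - |e_s⟩)`. -/
def diffVec (e : OrthonormalBasis (Fin m) ℂ H) (r s : Fin m) : H :=
  ((1 / √2 : ℝ) : ℂ) • (e r - e s)

/-- The `m + m(m-1)/2` component family `M_k = t^{-2} |ẽ_k⟩⟨ẽ_k|`, `k = 1, …, m`, and
`M_{rs} = (2/m) (1 - t^{-2}) |rs⟩⟨rs|`, `r < s`. For `t = 1` it is the square-root measurement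
`|e_k⟩⟨e_k|` (supplemented by zero components). -/
def pyramidObservable (e : OrthonormalBasis (Fin m) ℂ H) (t : ℝ) :
    Fin m ⊕ {q : Fin m × Fin m // q.1 < q.2} → H →L[ℂ] H
  | Sum.inl k => (((t ^ 2)⁻¹ : ℝ) : ℂ) • InnerProductSpace.rankOne ℂ (etilde e t k) (etilde e t k)
  | Sum.inr q => ((2 / (m : ℝ) * (1 - (t ^ 2)⁻¹) : ℝ) : ℂ) •
      InnerProductSpace.rankOne ℂ (diffVec e q.1.1 q.1.2) (diffVec e q.1.1 q.1.2)

end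

/-! ### The numerical parameters -/

/-- The coefficient `b = (√r₀ - √r₁)/√m` in `|ψ_j⟩ = a |e_j⟩ + b ∑_{k ≠ j} |e_k⟩`. -/
def coefB (m : ℕ) (r0 r1 : ℝ) : ℝ := (√r0 - √r1) / √(m : ℝ)

/-- The coefficient `a = √(m r₁) + (√r₀ - √r₁)/√m` in `|ψ_j⟩ = a |e_j⟩ + b ∑_{k ≠ j} |e_k⟩`. -/
def coefA (m : ℕ) (r0 r1 : ℝ) : ℝ := √(m * r1) + (√r0 - √r1) / √(m : ℝ)

/-- The value `log m + a² log a² + (m-1) b² log b²` (with `0 log 0 = 0`). -/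
def srmInfo (m : ℕ) (r0 r1 : ℝ) : ℝ :=
  Real.logb 2 m + coefA m r0 r1 ^ 2 * Real.logb 2 (coefA m r0 r1 ^ 2)
    + (m - 1) * coefB m r0 r1 ^ 2 * Real.logb 2 (coefB m r0 r1 ^ 2)

/-- The function whose zero determines the optimal parameter of nearly flat obtuse pyramids
(with `0 log 0 = 0`). -/
def gObt (m : ℕ) (τ : ℝ) : ℝ :=
  Real.logb 2 (m * (m - 1 + τ ^ 2) / 2)
    - (m - 1 + τ) / m * Real.logb 2 ((m - 1 + τ) ^ 2)
    - (1 - τ) / m * Real.logb 2 ((1 - τ) ^ 2)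

/-- `τ_o(m)`: the greatest zero of `gObt m` in `(-∞, 1]`. It is the only zero in `[0, 1]` for
`m ≤ 6`, and negative for `m ≥ 7`. -/
def tauObt (m : ℕ) : ℝ := sSup {τ : ℝ | τ ≤ 1 ∧ gObt m τ = 0}

/-- `p(m) = [1 + (m-1) (1 - m/(1 - τ_o(m)))^{-2}]^{-1}`. -/
def pObt (m : ℕ) : ℝ := (1 + (m - 1) * ((1 - m / (1 - tauObt m)) ^ 2)⁻¹)⁻¹

/-- The coefficient `μ̃₀(p)`. -/
def muTilde0 (m : ℕ) (p : ℝ) : ℝ :=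
  √(p * (1 - p) / (m - 1)) * (Real.logb 2 p - Real.logb 2 ((1 - p) / (m - 1))) /
    (((m - 1) * √((1 - p) / (m - 1)) - √p) * (√p + √((1 - p) / (m - 1))))

end QPyramid

end

/-!
The information given by an observable is a sum, over its outcomes, of the negative entropy
`∑ u_j log u_j - (∑ u_j) log (∑ u_j)` of the vector `u_j = ‖y_j‖²` of squared amplitudes. A majorant
of this function by a quadratic form `c ∑ ‖y_j‖² + μ ‖∑ y_j‖²` turns, since the components of the
observable sum to the unit operator, into a bound which is the same for all observables; and an
observable is optimal when its outcomes only involve amplitudes at which the majorant is sharp.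

The critical points of the difference are made of solutions of `z log z = v`, so that they have few
distinct coordinates. The majorant through the amplitudes `(1, -β, …, -β)` of the square-root
measurement holds when `c ≥ -log 2`, that is, when `gObt m τ ≤ 0`. At a zero of `gObt m` it is also
sharp at `(1, -1, 0, …, 0)`, the amplitudes along `|rs⟩`, which makes mixed observables optimal for
nearly flat pyramids.
-/

noncomputable section

namespace QPyramid

open Real

/-! ### Logarithmic inequalities and the coefficients of the majorant -/

lemma two_mul_log_le_sub_inv {x : ℝ} (hx : 1 ≤ x) : 2 * log x ≤ x - x⁻¹ := by
  have hsinh := self_le_sinh_iff.2 (log_nonneg hx)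
  rw [sinh_log (by linarith)] at hsinh
  linarith

lemma one_sub_sq_lt_neg_log_mul {t : ℝ} (ht0 : 0 < t) (ht1 : t < 1) :
    1 - t ^ 2 < -log t * (1 + t ^ 2) := by
  have hsq : t ^ 2 < 1 := pow_lt_one₀ ht0.le ht1 two_ne_zero
  have hlog := lt_log_one_add_of_pos (x := (t ^ 2)⁻¹ - 1)
    (sub_pos.2 ((one_lt_inv₀ (by positivity)).2 hsq))
  have hfrac : 2 * ((t ^ 2)⁻¹ - 1) / ((t ^ 2)⁻¹ - 1 + 2) = 2 * (1 - t ^ 2) / (1 + t ^ 2) := by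
    rw [show (t ^ 2)⁻¹ - 1 + 2 = (t ^ 2)⁻¹ + 1 by ring]
    field_simp
  rw [hfrac, add_sub_cancel, log_inv, log_pow, div_lt_iff₀ (by positivity)] at hlog
  push_cast at hlog
  linarith

lemma one_add_mul_lt_neg_log_mul {n t : ℝ} (hn : 1 ≤ n) (ht : 0 < t) (hnt : n * t < 1) :
    (1 + t) * (1 - n * t) < -log t * (1 + n * t ^ 2) := by
  have hlog := one_sub_sq_lt_neg_log_mul ht (by nlinarith)
  have hcross : (1 + t) * (1 - n * t) * (1 + t ^ 2) ≤ (1 - t ^ 2) * (1 + n * t ^ 2) := by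
    have : 0 ≤ (1 + t) * ((n - 1) * (t + t ^ 2)) := by positivity
    linarith
  refine lt_of_mul_lt_mul_right (a := 1 + t ^ 2) ?_ (by positivity)
  calc (1 + t) * (1 - n * t) * (1 + t ^ 2) ≤ (1 - t ^ 2) * (1 + n * t ^ 2) := hcross
    _ < -log t * (1 + t ^ 2) * (1 + n * t ^ 2) := by gcongr
    _ = -log t * (1 + n * t ^ 2) * (1 + t ^ 2) := by ring

/-- Coefficient of `∑ ‖y j‖ ^ 2` in the quadratic majorant of the negative entropy of
`(‖y j‖ ^ 2)` in `n + 1` variables that touches it at `(1, -β, …, -β)`. -/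
def constCoef (n β : ℝ) : ℝ := 2 * (β * log β) / (1 + β) - log (1 + n * β ^ 2)

/-- Coefficient of `‖∑ y j‖ ^ 2` in the quadratic majorant of the negative entropy of
`(‖y j‖ ^ 2)` in `n + 1` variables that touches it at `(1, -β, …, -β)`. At `n * β = 1`, where the
touching points satisfy `∑ y j = 0`, the value is the junk value `0`. -/
def sumCoef (n β : ℝ) : ℝ := -(2 * (β * log β)) / ((1 + β) * (1 - n * β))

lemma continuousAt_constCoef {n β : ℝ} (hn : 0 ≤ n) (hβ : 0 ≤ β) :
    ContinuousAt (constCoef n) β := by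
  have hlin : 1 + β ≠ 0 := by positivity
  have hquad : 1 + n * β ^ 2 ≠ 0 := by positivity
  exact ((continuous_mul_log.continuousAt.const_mul 2).div (by fun_prop) hlin).sub
    (ContinuousAt.log (by fun_prop) hquad)

lemma constCoef_strictAntiOn {n : ℝ} (hn : 1 ≤ n) :
    StrictAntiOn (constCoef n) (Set.Icc 0 (1 / n)) := by
  have hn0 : 0 < n := by linarith
  refine strictAntiOn_of_deriv_neg (convex_Icc _ _)
    (fun x hx => (continuousAt_constCoef hn0.le hx.1).continuousWithinAt) fun t ht => ?_
  rw [interior_Icc, Set.mem_Ioo, lt_div_iff₀' hn0] at ht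
  obtain ⟨ht0, hnt⟩ := ht
  have hlin : 0 < 1 + t := by positivity
  have hquad : 0 < 1 + n * t ^ 2 := by positivity
  have hderiv : HasDerivAt (constCoef n)
      ((2 * (log t + 1) * (1 + t) - 2 * (t * log t) * 1) / (1 + t) ^ 2
        - (n * (2 * t)) / (1 + n * t ^ 2)) t := by
    have hfrac := ((hasDerivAt_mul_log ht0.ne').const_mul 2).div
      ((hasDerivAt_id t).const_add 1) hlin.ne'
    have hlog := ((((hasDerivAt_id t).pow 2).const_mul n).const_add 1).log hquad.ne'
    exact (hfrac.sub hlog).congr_deriv (by simp)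
  rw [hderiv.deriv, sub_neg, div_lt_div_iff₀ (by positivity) hquad]
  linear_combination 2 * one_add_mul_lt_neg_log_mul hn ht0 hnt

lemma hasDerivAt_sumCoef {n t : ℝ} (ht : 0 < t) (hnt : n * t < 1) :
    HasDerivAt (sumCoef n)
      (2 * (-log t * (1 + n * t ^ 2) - (1 + t) * (1 - n * t)) / ((1 + t) * (1 - n * t)) ^ 2) t := by
  have hden : (1 + t) * (1 - n * t) ≠ 0 := by positivity
  refine (((hasDerivAt_mul_log ht.ne').const_mul 2).neg.div
    (((hasDerivAt_id t).const_add 1).mul (((hasDerivAt_id t).const_mul n).const_sub 1))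
    hden).congr_deriv ?_
  simp only [Pi.mul_apply, Pi.neg_apply, id]
  ring

lemma sumCoef_strictMonoOn {n : ℝ} (hn : 1 ≤ n) :
    StrictMonoOn (sumCoef n) (Set.Ioo 0 (1 / n)) := by
  have hmem : ∀ t ∈ Set.Ioo 0 (1 / n), 0 < t ∧ n * t < 1 := fun t ht =>
    ⟨ht.1, (lt_div_iff₀' (by linarith)).1 ht.2⟩
  refine strictMonoOn_of_deriv_pos (convex_Ioo _ _) (fun t ht => ?_) fun t ht => ?_
  · obtain ⟨ht0, hnt⟩ := hmem t ht
    exact (hasDerivAt_sumCoef ht0 hnt).continuousAt.continuousWithinAt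
  · obtain ⟨ht0, hnt⟩ := hmem t (interior_subset ht)
    rw [(hasDerivAt_sumCoef ht0 hnt).deriv]
    have hnum := sub_pos.2 (one_add_mul_lt_neg_log_mul hn ht0 hnt)
    positivity

lemma sumCoef_pos {n β : ℝ} (hn : 1 ≤ n) (hβ : 0 < β) (hnβ : n * β < 1) : 0 < sumCoef n β := by
  have hlog : β * log β < 0 := mul_log_neg hβ (by nlinarith)
  exact div_pos (by linarith) (by positivity)

/-! ### Solutions of `z log z = v` -/

lemma exp_sub_sq_le {l : ℝ} (hl0 : 0 ≤ l) (hl1 : l ≤ 1) :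
    exp l ^ 2 - 2 * l * exp l - 1 ≤ l ^ 3 * (1 / 3 + l / 3 + 29 / 100 * l ^ 2) := by
  have htaylor := exp_bound' hl0 hl1 (n := 6) (by norm_num)
  norm_num [Finset.sum_range_succ, Nat.factorial] at htaylor
  set T := 1 + l + l ^ 2 / 2 + l ^ 3 / 6 + l ^ 4 / 24 + l ^ 5 / 120 + l ^ 6 * 7 / 4320 with hT
  have hsq : (exp l - l) ^ 2 ≤ (T - l) ^ 2 := by
    have := add_one_le_exp l
    apply pow_le_pow_left₀ <;> linarith
  have hpoly : (T - l) ^ 2 - l ^ 2 - 1 ≤ l ^ 3 * (1 / 3 + l / 3 + 29 / 100 * l ^ 2) := by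
    have hpow : ∀ k : ℕ, l ^ k ≤ 1 := fun k => pow_le_one₀ hl0 hl1
    have hrem : 0 ≤ l ^ 5 * ((29 / 100 - 11 / 60) - 157 / 2160 * l - 1 / 45 * l ^ 2
        - 53 / 8640 * l ^ 3 - 1 / 810 * l ^ 4 - 53 / 259200 * l ^ 5 - 7 / 259200 * l ^ 6
        - 49 / 18662400 * l ^ 7) := by
      apply mul_nonneg (by positivity)
      linarith [hpow 2, hpow 3, hpow 4, hpow 5, hpow 6, hpow 7]
    rw [hT]
    linear_combination hrem
  linarith

lemma mul_cubic_le_exp_sub_one {y : ℝ} (hy : 0 ≤ y) :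
    y * (1 + y / 2 + y ^ 2 / 6 + y ^ 3 / 24) ≤ exp y - 1 := by
  have htaylor := sum_le_exp_of_nonneg hy 5
  norm_num [Finset.sum_range_succ, Nat.factorial] at htaylor
  linarith

lemma le_inv_cubic {l y : ℝ} (hl : 0 ≤ l) (hy : 0 < y) (h : l * (exp y - 1) = y) :
    l ≤ 1 / (1 + y / 2 + y ^ 2 / 6 + y ^ 3 / 24) := by
  rw [le_div_iff₀ (by positivity)]
  refine le_of_mul_le_mul_left ?_ hy
  calc y * (l * (1 + y / 2 + y ^ 2 / 6 + y ^ 3 / 24))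
      = l * (y * (1 + y / 2 + y ^ 2 / 6 + y ^ 3 / 24)) := by ring
    _ ≤ l * (exp y - 1) := mul_le_mul_of_nonneg_left (mul_cubic_le_exp_sub_one hy.le) hl
    _ = y * 1 := by rw [h, mul_one]

lemma exp_sub_sq_lt_exp_neg {l y : ℝ} (hl : 0 < l) (hy : 0 < y) (h : l * (exp y - 1) = y) :
    exp l ^ 2 - 2 * l * exp l - 1 < exp (-y) ^ 2 := by
  have hlD := le_inv_cubic hl.le hy h
  set D := 1 + y / 2 + y ^ 2 / 6 + y ^ 3 / 24 with hD
  have hD0 : 0 < D := by positivity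
  have hl1 : l ≤ 1 := hlD.trans ((div_le_one hD0).2 (by
    have : 0 ≤ y / 2 + y ^ 2 / 6 + y ^ 3 / 24 := by positivity
    linarith))
  have hpoly : (1 / D + y) ^ 2 * (1 / D) * (1 / 3 + (1 / D) / 3 + 29 / 100 * (1 / D) ^ 2) < 1 := by
    have hfrac : (1 / D + y) ^ 2 * (1 / D) * (1 / 3 + (1 / D) / 3 + 29 / 100 * (1 / D) ^ 2) =
        (1 + y * D) ^ 2 * (D ^ 2 / 3 + D / 3 + 29 / 100) / D ^ 5 := by
      field_simp
    rw [hfrac, div_lt_one (by positivity), ← sub_pos, hD]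
    ring_nf
    positivity
  have hexp : l * exp y = l + y := by linarith
  rw [exp_neg, inv_pow, ← one_div, lt_div_iff₀ (by positivity)]
  calc (exp l ^ 2 - 2 * l * exp l - 1) * exp y ^ 2
      ≤ l ^ 3 * (1 / 3 + l / 3 + 29 / 100 * l ^ 2) * exp y ^ 2 := by
        gcongr
        exact exp_sub_sq_le hl.le hl1
    _ = (l * exp y) ^ 2 * l * (1 / 3 + l / 3 + 29 / 100 * l ^ 2) := by ring
    _ ≤ (1 / D + y) ^ 2 * (1 / D) * (1 / 3 + (1 / D) / 3 + 29 / 100 * (1 / D) ^ 2) := by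
        rw [hexp]
        gcongr
    _ < 1 := hpoly

lemma one_sub_lt_sq_add_sq {α β : ℝ} (hα : 0 < α) (hαβ : α < β) (hβ : β < 1)
    (h : α * log α = β * log β) : 1 + 2 * (β * log β) < α ^ 2 + β ^ 2 := by
  have hβ0 : 0 < β := hα.trans hαβ
  have hratio : exp (log β - log α) = β / α := by rw [exp_sub, exp_log hβ0, exp_log hα]
  have hlog : -log β * (exp (log β - log α) - 1) = log β - log α := by
    rw [hratio]
    field_simp
    linarith
  have hlt := exp_sub_sq_lt_exp_neg (neg_pos.2 (log_neg hβ0 hβ))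
    (sub_pos.2 (log_lt_log hα hαβ)) hlog
  rw [exp_neg, exp_neg, exp_log hβ0, hratio, inv_div, div_pow, lt_div_iff₀ (by positivity)] at hlt
  field_simp at hlt
  linarith

lemma two_lt_sq_add_sq_add_sq {x α β : ℝ} (hx : 1 < x) (hα : 0 < α) (hαβ : α < β) (hβ : β < 1)
    (hxβ : x * log x = -(β * log β)) (h : α * log α = β * log β) :
    2 < x ^ 2 + α ^ 2 + β ^ 2 := by
  have hx0 : 0 < x := by linarith
  have hxsq : 1 + 2 * (x * log x) ≤ x ^ 2 := by
    have := mul_le_mul_of_nonneg_left (two_mul_log_le_sub_inv hx.le) hx0.le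
    rw [mul_sub, mul_inv_cancel₀ hx0.ne'] at this
    linarith
  linarith [one_sub_lt_sq_add_sq hα hαβ hβ h]

lemma one_lt_of_mul_log_pos {z : ℝ} (hz : 0 < z) (h : 0 < z * log z) : 1 < z :=
  (log_pos_iff hz.le).1 ((pos_iff_pos_of_mul_pos h).1 hz)

lemma neg_lt_one_of_mul_log_pos {z : ℝ} (hz : z < 0) (h : 0 < z * log z) : -z < 1 := by
  rw [← log_neg_iff (neg_pos.2 hz), log_neg_eq_log]
  exact (neg_iff_neg_of_mul_pos h).1 hz

lemma exists_pos_and_forall_ne_eq_neg {ι : Type*} [Fintype ι] {z : ι → ℝ} {v : ℝ} (hv : 0 < v)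
    (hz : ∀ j, z j * log (z j) = v) (hsum : 0 < ∑ j, z j) (hsq : ∑ j, z j ^ 2 < 2) :
    ∃ i, 0 < z i ∧ ∃ α, 0 < α ∧ ∀ j, j ≠ i → z j = -α := by
  classical
  have hsub (s : Finset ι) : ∑ j ∈ s, z j ^ 2 < 2 :=
    (Finset.sum_le_univ_sum_of_nonneg fun _ => sq_nonneg _).trans_lt hsq
  have hpos (j : ι) : 0 < z j * log (z j) := (hz j).symm ▸ hv
  obtain ⟨i, -, hi⟩ : ∃ i ∈ Finset.univ, 0 < z i := Finset.exists_lt_of_sum_lt (by simpa using hsum)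
  have hi1 : 1 < z i := one_lt_of_mul_log_pos hi (hpos i)
  have hneg (j : ι) (hj : j ≠ i) : z j < 0 := by
    refine (left_ne_zero_of_mul (hpos j).ne').lt_or_gt.resolve_right fun h => ?_
    have hj1 := one_lt_of_mul_log_pos h (hpos j)
    have hpair := hsub {i, j}
    rw [Finset.sum_pair hj.symm] at hpair
    nlinarith
  have hle (j k : ι) (hj : j ≠ i) (hk : k ≠ i) : -z k ≤ -z j := by
    by_contra! hlt
    have htriple := hsub {i, j, k}
    rw [Finset.sum_insert (by simp [hj.symm, hk.symm]),
      Finset.sum_pair (by rintro rfl; exact hlt.false)] at htriple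
    have := two_lt_sq_add_sq_add_sq hi1 (neg_pos.2 (hneg j hj)) hlt
      (neg_lt_one_of_mul_log_pos (hneg k hk) (hpos k))
      (by rw [log_neg_eq_log, neg_mul, neg_neg, hz, hz])
      (by rw [log_neg_eq_log, log_neg_eq_log, neg_mul, neg_mul, hz, hz])
    simp only [neg_sq] at this
    linarith
  refine ⟨i, hi, ?_⟩
  by_cases hex : ∃ k, k ≠ i
  · obtain ⟨k, hk⟩ := hex
    exact ⟨-z k, neg_pos.2 (hneg k hk), fun j hj => by linarith [hle j k hj hk, hle k j hk hj]⟩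
  · push Not at hex
    exact ⟨1, one_pos, fun j hj => absurd (hex j) hj⟩

/-! ### Quadratic majorants of the negative entropy -/

section Entropy

variable {ι : Type*} [Fintype ι]

/-- Minus the unnormalized Shannon entropy: `∑ u_j log u_j - N log N` with `N = ∑ u_j`, which is
`N` times the negative entropy of the distribution `u / N`. -/
def negEntropy (u : ι → ℝ) : ℝ := ∑ j, u j * log (u j) - (∑ j, u j) * log (∑ j, u j)

lemma continuous_negEntropy : Continuous (negEntropy : (ι → ℝ) → ℝ) :=
  (continuous_finsetSum _ fun j _ => continuous_mul_log.comp (continuous_apply j)).sub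
    (continuous_mul_log.comp (continuous_finsetSum _ fun j _ => continuous_apply j))

lemma negEntropy_smul (s : ℝ) (u : ι → ℝ) : negEntropy (s • u) = s * negEntropy u := by
  rcases eq_or_ne s 0 with rfl | hs
  · simp [negEntropy]
  have hterm (a : ℝ) : s * a * log (s * a) = s * log s * a + s * (a * log a) := by
    rcases eq_or_ne a 0 with rfl | ha
    · simp
    · rw [log_mul hs ha]
      ring
  simp only [negEntropy, Pi.smul_apply, smul_eq_mul, ← Finset.mul_sum, hterm,
    Finset.sum_add_distrib]
  ring

lemma negEntropy_nonpos {u : ι → ℝ} (hu : ∀ j, 0 ≤ u j) : negEntropy u ≤ 0 := by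
  rw [negEntropy, Finset.sum_mul, sub_nonpos]
  refine Finset.sum_le_sum fun j _ => ?_
  rcases (hu j).eq_or_lt with hj | hj
  · rw [← hj, zero_mul, zero_mul]
  · exact mul_le_mul_of_nonneg_left
      (log_le_log hj (Finset.single_le_sum (fun i _ => hu i) (Finset.mem_univ j))) hj.le

variable {V : Type*} [NormedAddCommGroup V]

/-- The quadratic form `c ∑ ‖y_j‖² + μ ‖∑ y_j‖²` in a family of vectors, used to bound
the negative entropy of `(‖y_j‖²)` from above. -/
def quadMajorant (c μ : ℝ) (y : ι → V) : ℝ := c * ∑ j, ‖y j‖ ^ 2 + μ * ‖∑ j, y j‖ ^ 2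

lemma exists_norm_eq_one_forall_le_mul_sq {E : Type*} [NormedAddCommGroup E] [NormedSpace ℝ E]
    [ProperSpace E] [Nontrivial E] {f : E → ℝ} (hf : Continuous f)
    (hsmul : ∀ (s : ℝ) (x : E), f (s • x) = s ^ 2 * f x) :
    ∃ x, ‖x‖ = 1 ∧ ∀ y, f y ≤ f x * ‖y‖ ^ 2 := by
  obtain ⟨x, hx, hmax⟩ := (isCompact_sphere (0 : E) 1).exists_isMaxOn
    (NormedSpace.sphere_nonempty.2 zero_le_one) hf.continuousOn
  refine ⟨x, mem_sphere_zero_iff_norm.1 hx, fun y => ?_⟩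
  rcases eq_or_ne y 0 with rfl | hy
  · simpa using (hsmul 0 0).le
  have hunit : ‖y‖⁻¹ • y ∈ Metric.sphere (0 : E) 1 := by
    simpa using norm_smul_inv_norm (𝕜 := ℝ) hy
  calc f y = f (‖y‖ • ‖y‖⁻¹ • y) := by rw [smul_inv_smul₀ (norm_ne_zero_iff.2 hy)]
    _ = f (‖y‖⁻¹ • y) * ‖y‖ ^ 2 := by rw [hsmul, mul_comm]
    _ ≤ f x * ‖y‖ ^ 2 := by gcongr; exact hmax hunit

lemma exists_touching_quadMajorant [NormedSpace ℝ V] [FiniteDimensional ℝ V] [Nontrivial V]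
    [Nonempty ι] (μ : ℝ) :
    ∃ (c : ℝ) (x : ι → V), ∑ j, ‖x j‖ ^ 2 = 1 ∧
      negEntropy (fun j => ‖x j‖ ^ 2) = quadMajorant c μ x ∧
      ∀ y : ι → V, negEntropy (fun j => ‖y j‖ ^ 2) ≤ quadMajorant c μ y := by
  let f : PiLp 2 (fun _ : ι => V) → ℝ := fun y =>
    negEntropy (fun j => ‖y j‖ ^ 2) - μ * ‖∑ j, y j‖ ^ 2
  have hcont : Continuous f := (continuous_negEntropy.comp (by fun_prop)).sub (by fun_prop)
  have hsmul (s : ℝ) (y : PiLp 2 fun _ : ι => V) : f (s • y) = s ^ 2 * f y := by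
    have hsq : (fun j => ‖(s • y) j‖ ^ 2) = s ^ 2 • fun j => ‖y j‖ ^ 2 := by
      funext j
      simp [norm_smul, mul_pow]
    simp only [f]
    rw [hsq, negEntropy_smul]
    simp only [PiLp.smul_apply, ← Finset.smul_sum, norm_smul, mul_pow, norm_eq_abs, sq_abs]
    ring
  have : ProperSpace (PiLp 2 fun _ : ι => V) := FiniteDimensional.proper ℝ _
  obtain ⟨x, hx, hmax⟩ := exists_norm_eq_one_forall_le_mul_sq hcont hsmul
  have hnorm : ∑ j, ‖x j‖ ^ 2 = 1 := by rw [← PiLp.norm_sq_eq_of_L2, hx, one_pow]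
  refine ⟨f x, x, hnorm, ?_, fun y => ?_⟩
  · rw [quadMajorant, hnorm]
    ring
  · have hy := hmax (WithLp.toLp 2 y)
    rw [PiLp.norm_sq_eq_of_L2] at hy
    rw [quadMajorant]
    linarith

variable [InnerProductSpace ℝ V]

lemma hasDerivAt_norm_add_smul_sq (x d : V) :
    HasDerivAt (fun t : ℝ => ‖x + t • d‖ ^ 2) (2 * inner ℝ x d) 0 := by
  have hline : HasDerivAt (fun t : ℝ => x + t • d) d 0 := by
    simpa using ((hasDerivAt_id (0 : ℝ)).smul_const d).const_add x
  simpa using hline.norm_sq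

lemma hasDerivAt_sq_mul_log_sq_zero : HasDerivAt (fun s : ℝ => s ^ 2 * log (s ^ 2)) 0 0 := by
  rw [hasDerivAt_iff_tendsto_slope_zero]
  have hlim : Filter.Tendsto (fun s : ℝ => 2 * (s * log s)) (nhdsWithin 0 {0}ᶜ) (nhds 0) := by
    simpa using ((continuous_mul_log.const_mul 2).tendsto 0).mono_left nhdsWithin_le_nhds
  refine hlim.congr' ?_
  filter_upwards [self_mem_nhdsWithin] with s hs
  rw [Set.mem_compl_singleton_iff] at hs
  simp only [zero_add, smul_eq_mul, log_pow, log_zero]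
  field_simp
  push_cast
  ring

lemma hasDerivAt_norm_sq_mul_log (x d : V) :
    HasDerivAt (fun t : ℝ => ‖x + t • d‖ ^ 2 * log (‖x + t • d‖ ^ 2))
      ((log (‖x‖ ^ 2) + 1) * (2 * inner ℝ x d)) 0 := by
  rcases eq_or_ne x 0 with rfl | hx
  · have hscale : HasDerivAt (fun t : ℝ => t * ‖d‖) (1 * ‖d‖) 0 := (hasDerivAt_id 0).mul_const _
    have hsq : HasDerivAt (fun s : ℝ => s ^ 2 * log (s ^ 2)) 0 (0 * ‖d‖) := by
      rw [zero_mul]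
      exact hasDerivAt_sq_mul_log_sq_zero
    refine ((hsq.comp (0 : ℝ) hscale).congr_of_eventuallyEq
      (.of_forall fun t => ?_)).congr_deriv (by simp)
    simp only [zero_add, norm_smul, norm_eq_abs, mul_pow, sq_abs, Function.comp_apply]
  · have hlog : HasDerivAt (fun u => u * log u) (log (‖x‖ ^ 2) + 1) (‖x + (0 : ℝ) • d‖ ^ 2) := by
      rw [zero_smul, add_zero]
      exact hasDerivAt_mul_log (pow_ne_zero 2 (norm_ne_zero_iff.2 hx))
    exact HasDerivAt.comp (0 : ℝ) hlog (hasDerivAt_norm_add_smul_sq x d)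

lemma hasDerivAt_negEntropy_norm_sq {x : ι → V} (hx : ∑ j, ‖x j‖ ^ 2 = 1) (d : ι → V) :
    HasDerivAt (fun t : ℝ => negEntropy fun j => ‖x j + t • d j‖ ^ 2)
      (∑ j, log (‖x j‖ ^ 2) * (2 * inner ℝ (x j) (d j))) 0 := by
  have hsum : HasDerivAt (fun t : ℝ => ∑ j, ‖x j + t • d j‖ ^ 2)
      (∑ j, 2 * inner ℝ (x j) (d j)) 0 :=
    HasDerivAt.fun_sum fun j _ => hasDerivAt_norm_add_smul_sq (x j) (d j)
  have htotal := HasDerivAt.comp (0 : ℝ)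
    (h₂ := fun u => u * log u) (h₂' := 1)
    (by simpa [hx] using hasDerivAt_mul_log one_ne_zero) hsum
  refine ((HasDerivAt.fun_sum fun j _ =>
    hasDerivAt_norm_sq_mul_log (x j) (d j)).sub htotal).congr_deriv ?_
  simp only [add_mul, one_mul, Finset.sum_add_distrib, add_sub_cancel_right]

lemma hasDerivAt_quadMajorant (c μ : ℝ) (x d : ι → V) :
    HasDerivAt (fun t : ℝ => quadMajorant c μ fun j => x j + t • d j)
      (c * ∑ j, 2 * inner ℝ (x j) (d j) + μ * (2 * inner ℝ (∑ j, x j) (∑ j, d j))) 0 := by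
  simp only [quadMajorant, Finset.sum_add_distrib, ← Finset.smul_sum]
  exact ((HasDerivAt.fun_sum fun j _ => hasDerivAt_norm_add_smul_sq (x j) (d j)).const_mul c).add
    ((hasDerivAt_norm_add_smul_sq _ _).const_mul μ)

lemma smul_eq_smul_sum_of_touching {c μ : ℝ} {x : ι → V} (hx : ∑ j, ‖x j‖ ^ 2 = 1)
    (htouch : negEntropy (fun j => ‖x j‖ ^ 2) = quadMajorant c μ x)
    (hle : ∀ y : ι → V, negEntropy (fun j => ‖y j‖ ^ 2) ≤ quadMajorant c μ y) (j : ι) :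
    (log (‖x j‖ ^ 2) - c) • x j = μ • ∑ i, x i := by
  classical
  refine ext_inner_right ℝ fun v => ?_
  let d : ι → V := Pi.single j v
  have hmax : IsLocalMax (fun t : ℝ => negEntropy (fun i => ‖x i + t • d i‖ ^ 2) -
      quadMajorant c μ fun i => x i + t • d i) 0 :=
    Filter.Eventually.of_forall fun t => by
      simpa [htouch] using hle fun i => x i + t • d i
  have hderiv := hmax.hasDerivAt_eq_zero
    ((hasDerivAt_negEntropy_norm_sq hx d).sub (hasDerivAt_quadMajorant c μ x d))
  have hsingle (a : ι → ℝ) :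
      ∑ i, a i * (2 * inner ℝ (x i) (d i)) = a j * (2 * inner ℝ (x j) v) := by
    rw [Finset.sum_eq_single j (fun i _ hi => by simp [d, hi]) (by simp)]
    simp [d]
  have hsingle_one := hsingle 1
  simp only [Pi.one_apply, one_mul] at hsingle_one
  rw [hsingle, hsingle_one, Fintype.sum_pi_single' j v] at hderiv
  rw [real_inner_smul_left, real_inner_smul_left]
  linarith

lemma le_neg_log_two_of_sum_eq_zero {c : ℝ} {x : ι → V} (hx : ∑ j, ‖x j‖ ^ 2 = 1)
    (hstat : ∀ j, (log (‖x j‖ ^ 2) - c) • x j = 0) (hsum : ∑ j, x j = 0) : c ≤ -log 2 := by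
  classical
  have hmod (j : ι) (hj : x j ≠ 0) : ‖x j‖ ^ 2 = exp c := by
    have hlog := (smul_eq_zero.1 (hstat j)).resolve_right hj
    rw [← sub_eq_zero.1 hlog, exp_log (by positivity)]
  obtain ⟨i, hi⟩ : ∃ i, x i ≠ 0 := by
    by_contra! hall
    simp [hall] at hx
  obtain ⟨j, hji, hj⟩ : ∃ j, j ≠ i ∧ x j ≠ 0 := by
    by_contra! hall
    rw [Finset.sum_eq_single i (fun j _ hj => hall j hj) (by simp)] at hsum
    exact hi hsum
  have hpair : exp c + exp c ≤ 1 := by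
    calc exp c + exp c = ∑ k ∈ {i, j}, ‖x k‖ ^ 2 := by
          rw [Finset.sum_pair hji.symm, hmod i hi, hmod j hj]
      _ ≤ ∑ k, ‖x k‖ ^ 2 := Finset.sum_le_univ_sum_of_nonneg fun _ => sq_nonneg _
      _ = 1 := hx
  rw [← log_inv, le_log_iff_exp_le (by norm_num)]
  linarith

lemma exists_sum_eq_of_smul_eq_smul_sum {μ : ℝ} {a : ι → ℝ} {x : ι → V} (hμ : μ ≠ 0)
    (hstat : ∀ j, a j • x j = μ • ∑ i, x i) (hsum : ∑ j, x j ≠ 0) :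
    ∃ r : ι → ℝ, (∀ j, ‖x j‖ ^ 2 = r j ^ 2) ∧ ∑ j, r j = ‖∑ j, x j‖ ∧
      ∀ j, a j * r j = μ * ‖∑ i, x i‖ := by
  set S := ∑ i, x i with hS
  have ha (j : ι) : a j ≠ 0 := by
    intro h
    have := hstat j
    rw [h, zero_smul] at this
    exact smul_ne_zero hμ hsum this.symm
  have hx (j : ι) : x j = (μ / a j) • S := by
    rw [div_eq_inv_mul, mul_smul, ← hstat j, inv_smul_smul₀ (ha j)]
  have hone : ∑ j, μ / a j = 1 := by
    refine smul_left_injective ℝ hsum ?_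
    simp only [Finset.sum_smul, ← hx, one_smul]
    exact hS.symm
  refine ⟨fun j => μ / a j * ‖S‖, fun j => ?_, ?_, fun j => ?_⟩
  · rw [hx j, norm_smul, mul_pow, mul_pow, norm_eq_abs, sq_abs]
  · rw [← Finset.sum_mul, hone, one_mul]
  · rw [← mul_assoc, mul_div_cancel₀ _ (ha j)]

end Entropy

section CriticalPoints

variable {ι : Type*} [Fintype ι]

lemma exists_forall_ne_eq_neg_mul {r : ι → ℝ} {c v : ℝ} (hv : 0 < v)
    (hr : ∀ j, (log (r j ^ 2) - c) * r j = v) (hsum : 0 < ∑ j, r j) (hsq : ∑ j, r j ^ 2 = 1)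
    (hc : -log 2 < c) : ∃ i, 0 < r i ∧ ∃ t, 0 < t ∧ ∀ j, j ≠ i → r j = -(t * r i) := by
  have hr0 (j : ι) : r j ≠ 0 := by
    intro h
    have := hr j
    rw [h, mul_zero] at this
    exact hv.ne this
  set q := exp (-c / 2) with hq
  have hq0 : 0 < q := exp_pos _
  have hscaled (j : ι) : q * r j * log (q * r j) = q * v / 2 := by
    rw [log_mul hq0.ne' (hr0 j), hq, log_exp, ← hr j, log_pow]
    push_cast
    ring
  have hscaled_sq : ∑ j, (q * r j) ^ 2 < 2 := by
    simp only [mul_pow]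
    rw [← Finset.mul_sum, hsq, mul_one, hq, ← exp_nat_mul, ← lt_log_iff_exp_lt two_pos]
    push_cast
    linarith
  obtain ⟨i, hi, α, hα, hothers⟩ := exists_pos_and_forall_ne_eq_neg (by positivity) hscaled
    (by rw [← Finset.mul_sum]; positivity) hscaled_sq
  have hri : 0 < r i := pos_of_mul_pos_right hi hq0.le
  refine ⟨i, hri, α / (q * r i), by positivity, fun j hj => ?_⟩
  have := hothers j hj
  field_simp
  linarith

lemma sumCoef_constCoef_eq_of_stationary {n X t c μ : ℝ} (hX : 0 < X) (ht : 0 < t)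
    (hnt : n * t < 1) (hnorm : X ^ 2 * (1 + n * t ^ 2) = 1)
    (hapex : log (X ^ 2) - c = μ * (1 - n * t))
    (hother : (log ((t * X) ^ 2) - c) * t = -(μ * (1 - n * t))) :
    sumCoef n t = μ ∧ constCoef n t = c := by
  have hden : 0 < 1 - n * t := by linarith
  rw [mul_pow, log_mul (by positivity) (by positivity), log_pow t] at hother
  push_cast at hother
  have hmul : 2 * (t * log t) = -(μ * (1 - n * t)) * (1 + t) := by
    linear_combination hother - t * hapex
  have hlogX : log (X ^ 2) = -log (1 + n * t ^ 2) := by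
    rw [eq_inv_of_mul_eq_one_left hnorm, log_inv]
  constructor
  · rw [sumCoef, hmul]
    field_simp
  · rw [constCoef, hmul, mul_div_cancel_right₀ _ (by positivity)]
    linarith

lemma sum_eq_add_smul_of_forall_ne_eq {E : Type*} [AddCommGroup E] [Module ℝ E] {n : ℝ}
    (hcard : (Fintype.card ι : ℝ) = n + 1) {f : ι → E} {i : ι} {b : E}
    (hf : ∀ j, j ≠ i → f j = b) : ∑ j, f j = f i + n • b := by
  classical
  rw [← Finset.add_sum_erase _ _ (Finset.mem_univ i),
    Finset.sum_congr rfl fun j hj => hf j (Finset.ne_of_mem_erase hj), Finset.sum_const,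
    Finset.card_erase_of_mem (Finset.mem_univ i), Finset.card_univ, ← Nat.cast_smul_eq_nsmul ℝ,
    Nat.cast_sub (Fintype.card_pos_iff.2 ⟨i⟩), hcard, Nat.cast_one, add_sub_cancel_right]

lemma exists_sumCoef_constCoef_eq {n : ℝ} (hcard : (Fintype.card ι : ℝ) = n + 1) (hn : 1 ≤ n)
    {r : ι → ℝ} {c μ : ℝ} (hμ : 0 < μ) (hr : ∀ j, (log (r j ^ 2) - c) * r j = μ * ∑ i, r i)
    (hsum : 0 < ∑ j, r j) (hsq : ∑ j, r j ^ 2 = 1) (hc : -log 2 < c) :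
    ∃ t, 0 < t ∧ n * t < 1 ∧ sumCoef n t = μ ∧ constCoef n t = c := by
  obtain ⟨i, hi, t, ht, hothers⟩ := exists_forall_ne_eq_neg_mul (mul_pos hμ hsum) hr hsum hsq hc
  have hsum_eq : ∑ j, r j = r i * (1 - n * t) := by
    rw [sum_eq_add_smul_of_forall_ne_eq hcard hothers]
    ring
  have hsq_eq : r i ^ 2 * (1 + n * t ^ 2) = 1 := by
    rw [sum_eq_add_smul_of_forall_ne_eq (f := fun j => r j ^ 2) hcard
      fun j hj => by rw [hothers j hj]] at hsq
    linear_combination hsq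
  have hnt : 0 < 1 - n * t := pos_of_mul_pos_right (hsum_eq ▸ hsum) hi.le
  obtain ⟨j, hj⟩ : ∃ j, j ≠ i := by
    have : Nontrivial ι := Fintype.one_lt_card_iff_nontrivial.1 (by
      have : (1 : ℝ) < Fintype.card ι := by linarith
      exact_mod_cast this)
    exact exists_ne i
  have hapex := hr i
  have hother := hr j
  rw [hsum_eq] at hapex hother
  rw [hothers j hj, neg_sq] at hother
  exact ⟨t, ht, by linarith, sumCoef_constCoef_eq_of_stationary hi ht (by linarith)
    hsq_eq (mul_right_cancel₀ hi.ne' (by linarith)) (mul_right_cancel₀ hi.ne' (by linarith))⟩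

end CriticalPoints

section Majorant

variable {ι : Type*} [Fintype ι] {V : Type*} [NormedAddCommGroup V] [InnerProductSpace ℝ V]
  [FiniteDimensional ℝ V]

lemma negEntropy_le_quadMajorant_of_mem_Ioo {n β : ℝ} (hcard : (Fintype.card ι : ℝ) = n + 1)
    (hn : 1 ≤ n) (hβ : 0 < β) (hnβ : n * β < 1) (hcoef : -log 2 ≤ constCoef n β) (y : ι → V) :
    negEntropy (fun j => ‖y j‖ ^ 2) ≤ quadMajorant (constCoef n β) (sumCoef n β) y := by
  rcases subsingleton_or_nontrivial V with hV | hV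
  · simp [Subsingleton.elim _ (0 : V), negEntropy, quadMajorant]
  have : Nonempty ι := Fintype.card_pos_iff.1 (by
    have : (0 : ℝ) < Fintype.card ι := by linarith
    exact_mod_cast this)
  have hμ := sumCoef_pos hn hβ hnβ
  obtain ⟨c, x, hx, htouch, hle⟩ := exists_touching_quadMajorant (ι := ι) (V := V) (sumCoef n β)
  have hstat := smul_eq_smul_sum_of_touching hx htouch hle
  suffices hc : c ≤ constCoef n β by
    refine (hle y).trans ?_
    unfold quadMajorant
    gcongr
  by_contra! hlt
  by_cases hsum : ∑ j, x j = 0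
  · simp only [hsum, smul_zero] at hstat
    exact absurd (le_neg_log_two_of_sum_eq_zero hx hstat hsum) (by linarith)
  obtain ⟨r, hxr, hrsum, hr⟩ := exists_sum_eq_of_smul_eq_smul_sum hμ.ne' hstat hsum
  simp only [hxr, ← hrsum] at hr hx
  obtain ⟨t, ht, hnt, hsumCoef, hconst⟩ := exists_sumCoef_constCoef_eq hcard hn hμ hr
    (hrsum ▸ norm_pos_iff.2 hsum) hx (by linarith)
  have hn0 : 0 < n := by linarith
  have htβ : t = β := (sumCoef_strictMonoOn hn).injOn ⟨ht, (lt_div_iff₀' hn0).2 hnt⟩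
    ⟨hβ, (lt_div_iff₀' hn0).2 hnβ⟩ hsumCoef
  exact hlt.ne (htβ ▸ hconst)

lemma negEntropy_le_quadMajorant {n β : ℝ} (hcard : (Fintype.card ι : ℝ) = n + 1) (hn : 1 ≤ n)
    (hβ : 0 ≤ β) (hnβ : n * β ≤ 1) (hcoef : -log 2 ≤ constCoef n β) {y : ι → V}
    (hy : n * β = 1 → ∑ j, y j = 0) :
    negEntropy (fun j => ‖y j‖ ^ 2) ≤ quadMajorant (constCoef n β) (sumCoef n β) y := by
  rcases hβ.eq_or_lt with rfl | hβ0
  · simpa [quadMajorant, constCoef, sumCoef] using negEntropy_nonpos fun j => sq_nonneg ‖y j‖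
  rcases hnβ.lt_or_eq with hlt | heq
  · exact negEntropy_le_quadMajorant_of_mem_Ioo hcard hn hβ0 hlt hcoef y
  have hn0 : 0 < n := by linarith
  have hβn : β = 1 / n := eq_div_of_mul_eq hn0.ne' (by linarith)
  have hbelow : ∀ b ∈ Set.Ioo 0 β,
      negEntropy (fun j => ‖y j‖ ^ 2) ≤ constCoef n b * ∑ j, ‖y j‖ ^ 2 := by
    intro b hb
    have hanti := constCoef_strictAntiOn hn ⟨hb.1.le, hβn ▸ hb.2.le⟩ ⟨hβ, hβn.le⟩ hb.2
    have := negEntropy_le_quadMajorant_of_mem_Ioo hcard hn hb.1 (by nlinarith [hb.2])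
      (hcoef.trans hanti.le) y
    simpa [quadMajorant, hy heq] using this
  have hlim : Filter.Tendsto (fun b => constCoef n b * ∑ j, ‖y j‖ ^ 2)
      (nhdsWithin β (Set.Iio β)) (nhds (constCoef n β * ∑ j, ‖y j‖ ^ 2)) :=
    ((continuousAt_constCoef hn0.le hβ).tendsto.mono_left nhdsWithin_le_nhds).mul_const _
  simpa [quadMajorant, hy heq] using
    ge_of_tendsto hlim (Filter.mem_of_superset (Ioo_mem_nhdsLT hβ0) hbelow)

end Majorant

section Touching

variable {ι : Type*} [Fintype ι] {V : Type*} [NormedAddCommGroup V]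

lemma constCoef_mul_add_sumCoef_mul {n β : ℝ} (hβ : 0 ≤ β) :
    constCoef n β * (1 + n * β ^ 2) + sumCoef n β * (1 - n * β) ^ 2 =
      n * (β ^ 2 * log (β ^ 2)) - (1 + n * β ^ 2) * log (1 + n * β ^ 2) := by
  have hβ1 : 1 + β ≠ 0 := by positivity
  rw [log_pow]
  unfold constCoef sumCoef
  by_cases hflat : 1 - n * β = 0
  · rw [show 1 + n * β ^ 2 = 1 + β by linear_combination -β * hflat, hflat]
    field_simp
    linear_combination (2 * β * log β + 2 * β ^ 2 * log β) * hflat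
  · field_simp
    ring

lemma negEntropy_eq_quadMajorant_of_forall_ne_eq_neg_smul [NormedSpace ℝ V] {n β : ℝ}
    (hcard : (Fintype.card ι : ℝ) = n + 1) (hβ : 0 ≤ β) {y : ι → V} {i : ι}
    (hy : ∀ j, j ≠ i → y j = -(β • y i)) :
    negEntropy (fun j => ‖y j‖ ^ 2) = quadMajorant (constCoef n β) (sumCoef n β) y := by
  classical
  let w : ι → ℝ := fun j => if j = i then 1 else β ^ 2
  have hwi : w i = 1 := if_pos rfl
  have hw : ∀ j, j ≠ i → w j = β ^ 2 := fun j hj => if_neg hj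
  have hsq : (fun j => ‖y j‖ ^ 2) = ‖y i‖ ^ 2 • w := by
    funext j
    by_cases hj : j = i
    · simp [w, hj]
    · simp [w, hj, hy j hj, norm_smul, mul_pow, mul_comm]
  have hsum : ‖∑ j, y j‖ ^ 2 = (1 - n * β) ^ 2 * ‖y i‖ ^ 2 := by
    rw [sum_eq_add_smul_of_forall_ne_eq hcard hy,
      show y i + n • -(β • y i) = (1 - n * β) • y i by module, norm_smul, mul_pow,
      norm_eq_abs, sq_abs]
  have hsumw : ∑ j, w j = 1 + n * β ^ 2 := by
    rw [sum_eq_add_smul_of_forall_ne_eq hcard hw, hwi, smul_eq_mul]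
  have hsumlog : ∑ j, w j * log (w j) = n * (β ^ 2 * log (β ^ 2)) := by
    rw [sum_eq_add_smul_of_forall_ne_eq (f := fun j => w j * log (w j)) hcard
      fun j hj => by rw [hw j hj], hwi, log_one, mul_zero, zero_add, smul_eq_mul]
  have hsumsq : ∑ j, ‖y j‖ ^ 2 = ‖y i‖ ^ 2 * (1 + n * β ^ 2) := by
    rw [← hsumw, Finset.mul_sum]
    exact Finset.sum_congr rfl fun j _ => congrFun hsq j
  rw [quadMajorant, hsumsq, hsum, hsq, negEntropy_smul, negEntropy, hsumw, hsumlog]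
  linear_combination -‖y i‖ ^ 2 * constCoef_mul_add_sumCoef_mul (n := n) hβ

lemma negEntropy_eq_quadMajorant_of_eq_neg (μ : ℝ) {y : ι → V} {r s : ι} (hrs : r ≠ s)
    (hyr : y r = -y s) (hy : ∀ j, j ≠ r → j ≠ s → y j = 0) :
    negEntropy (fun j => ‖y j‖ ^ 2) = quadMajorant (-log 2) μ y := by
  have hpair {f : ι → ℝ} (hf : ∀ j, y j = 0 → f j = 0) :
      ∑ j, f j = f r + f s :=
    Fintype.sum_eq_add r s hrs fun j hj => hf j (hy j hj.1 hj.2)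
  have hlog : ‖y s‖ ^ 2 * log (‖y s‖ ^ 2 + ‖y s‖ ^ 2) = ‖y s‖ ^ 2 * (log 2 + log (‖y s‖ ^ 2)) := by
    rcases eq_or_ne (y s) 0 with h0 | h0
    · simp [h0]
    · rw [← two_mul, log_mul two_ne_zero (by positivity)]
  rw [quadMajorant, negEntropy, hpair fun j hj => by simp [hj], hpair fun j hj => by simp [hj],
    Fintype.sum_eq_add r s hrs fun j hj => hy j hj.1 hj.2, hyr, norm_neg, neg_add_cancel, norm_zero]
  linear_combination -2 * hlog

end Touching

/-! ### Equiprobable pure states -/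

section Ensemble

open InnerProductSpace (rankOne rankOne_apply rankOne_comp trace_rankOne)

variable {ι κ : Type*} [Fintype ι] [Fintype κ] {H : Type*} [NormedAddCommGroup H]
  [InnerProductSpace ℂ H]

lemma reApplyInnerSelf_ofReal_smul_rankOne (a : ℝ) (v x : H) :
    ((a : ℂ) • rankOne ℂ v v).reApplyInnerSelf x = a * ‖inner ℂ v x‖ ^ 2 := by
  rw [ContinuousLinearMap.reApplyInnerSelf_apply, _root_.smul_apply, rankOne_apply,
    inner_smul_left, inner_smul_left, Complex.conj_ofReal, Complex.conj_mul', ← Complex.ofReal_pow,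
    ← Complex.ofReal_mul]
  exact Complex.ofReal_re _

lemma IsObservable.sum_reApplyInnerSelf {M : κ → H →L[ℂ] H} (hM : IsObservable M) (x : H) :
    ∑ k, (M k).reApplyInnerSelf x = ‖x‖ ^ 2 := by
  simp only [ContinuousLinearMap.reApplyInnerSelf_apply]
  rw [← map_sum, ← sum_inner, ← _root_.sum_apply, hM.2, ContinuousLinearMap.id_apply,
    inner_self_eq_norm_sq]

lemma IsObservable.comp_equiv {κ' : Type*} [Fintype κ'] {M : κ → H →L[ℂ] H}
    (hM : IsObservable M) (f : κ' ≃ κ) : IsObservable (M ∘ f) :=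
  ⟨fun k => hM.1 (f k), (f.sum_comp M).trans hM.2⟩

variable [FiniteDimensional ℂ H]

lemma mutualInfo_comp_equiv {κ' : Type*} [Fintype κ'] (E : Ensemble ι H) (M : κ → H →L[ℂ] H)
    (f : κ' ≃ κ) : mutualInfo E (M ∘ f) = mutualInfo E M :=
  Finset.sum_congr rfl fun j _ => f.sum_comp fun k => jointProb E M j k *
    Real.logb 2 (jointProb E M j k / (E.prob j * outcomeProb E M k))

lemma IsInfoOptimal.accessibleInfo_eq {E : Ensemble ι H} {M : κ → H →L[ℂ] H}
    (hM : IsInfoOptimal E M) : accessibleInfo E = mutualInfo E M := by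
  have hgreatest : IsGreatest (infoValues E) (mutualInfo E M) := by
    refine ⟨⟨Fintype.card κ, M ∘ (Fintype.equivFin κ).symm, hM.1.comp_equiv _,
      (mutualInfo_comp_equiv E M _).symm⟩, ?_⟩
    rintro _ ⟨n, N, hN, rfl⟩
    exact hM.2 n N hN
  exact hgreatest.csSup_eq

/-- The ensemble `E` consists of the equiprobable pure states `|ψ j⟩⟨ψ j|`. -/
structure IsEquiprobablePure (E : Ensemble ι H) (ψ : ι → H) : Prop where
  prob_eq : ∀ j, E.prob j = 1 / Fintype.card ι
  state_eq : ∀ j, E.state j = rankOne ℂ (ψ j) (ψ j)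

lemma mul_logb_div_eq {N w W : ℝ} (hN : 0 < N) (hw : 0 ≤ w) (hwW : w ≤ W) :
    1 / N * w * logb 2 (1 / N * w / (1 / N * (1 / N * W))) =
      (w * log w - w * log W) / (N * log 2) + logb 2 N / N * w := by
  rcases hw.eq_or_lt with rfl | hw
  · simp
  have hlog2 : log 2 ≠ 0 := (log_pos one_lt_two).ne'
  have hW : 0 < W := hw.trans_le hwW
  rw [show 1 / N * w / (1 / N * (1 / N * W)) = N * w / W by field_simp, logb, logb,
    log_div (by positivity) hW.ne', log_mul hN.ne' hw.ne']
  field_simp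
  ring

variable {E : Ensemble ι H} {ψ : ι → H} {M : κ → H →L[ℂ] H}

/-- The bound on the information of an observable which the majorant touching at `(1, -β, …, -β)`
gives for `N` equiprobable pure states `ψ j` with `‖∑ ψ j‖ ^ 2 / N = σ`. -/
def infoBound (N σ β : ℝ) : ℝ :=
  logb 2 N + (constCoef (N - 1) β + sumCoef (N - 1) β * σ) / log 2

namespace IsEquiprobablePure

lemma norm_eq_one (hE : IsEquiprobablePure E ψ) (j : ι) : ‖ψ j‖ = 1 := by
  have htrace := E.state_trace j
  rw [hE.state_eq, trace_rankOne] at htrace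
  rw [← pow_eq_one_iff_of_nonneg (norm_nonneg _) two_ne_zero, ← inner_self_eq_norm_sq (𝕜 := ℂ),
    htrace, RCLike.one_re]

lemma card_pos (hE : IsEquiprobablePure E ψ) : (0 : ℝ) < Fintype.card ι := by
  refine (Nat.cast_nonneg _).lt_of_ne fun hcard => ?_
  have hsum := E.prob_sum
  simp [hE.prob_eq, ← hcard] at hsum

lemma jointProb_eq {κ : Type*} (hE : IsEquiprobablePure E ψ) (M : κ → H →L[ℂ] H) (j : ι) (k : κ) :
    jointProb E M j k = 1 / Fintype.card ι * (M k).reApplyInnerSelf (ψ j) := by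
  have : CompleteSpace H := FiniteDimensional.complete ℂ H
  rw [jointProb, hE.prob_eq, hE.state_eq, rankOne_comp,
    trace_rankOne, ContinuousLinearMap.adjoint_inner_left,
    ContinuousLinearMap.reApplyInnerSelf_apply, inner_re_symm]
  rfl

lemma mutualInfo_eq (hE : IsEquiprobablePure E ψ) (hM : IsObservable M) :
    mutualInfo E M = logb 2 (Fintype.card ι) +
      (∑ k, negEntropy fun j => (M k).reApplyInnerSelf (ψ j)) / (Fintype.card ι * log 2) := by
  have hN := hE.card_pos
  have hterm (j : ι) (k : κ) := mul_logb_div_eq hN ((hM.1 k).2 (ψ j)) (Finset.single_le_sum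
    (f := fun i => (M k).reApplyInnerSelf (ψ i)) (fun i _ => (hM.1 k).2 _) (Finset.mem_univ j))
  have hnorm : ∑ j, ∑ k, (M k).reApplyInnerSelf (ψ j) = Fintype.card ι := by
    simp [hM.sum_reApplyInnerSelf, hE.norm_eq_one]
  simp only [mutualInfo, outcomeProb, hE.jointProb_eq, hE.prob_eq, ← Finset.mul_sum]
  simp only [hterm, Finset.sum_add_distrib, ← Finset.sum_div, ← Finset.mul_sum, hnorm]
  rw [Finset.sum_comm, add_comm, div_mul_cancel₀ _ hN.ne']
  simp only [negEntropy, Finset.sum_sub_distrib, Finset.sum_mul]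

lemma sum_quadMajorant_form (hE : IsEquiprobablePure E ψ) (hM : IsObservable M) (c μ : ℝ) :
    ∑ k, (c * ∑ j, (M k).reApplyInnerSelf (ψ j) + μ * (M k).reApplyInnerSelf (∑ j, ψ j)) =
      c * Fintype.card ι + μ * ‖∑ j, ψ j‖ ^ 2 := by
  rw [Finset.sum_add_distrib, ← Finset.mul_sum, ← Finset.mul_sum, Finset.sum_comm,
    hM.sum_reApplyInnerSelf]
  simp [hM.sum_reApplyInnerSelf, hE.norm_eq_one]

lemma mutualInfo_le_of_negEntropy_le (hE : IsEquiprobablePure E ψ) (hM : IsObservable M) {c μ : ℝ}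
    (hle : ∀ B : H →L[ℂ] H,
      negEntropy (fun j => ‖B (ψ j)‖ ^ 2) ≤ quadMajorant c μ fun j => B (ψ j)) :
    mutualInfo E M ≤ logb 2 (Fintype.card ι) +
      (c + μ * (‖∑ j, ψ j‖ ^ 2 / Fintype.card ι)) / log 2 := by
  have : CompleteSpace H := FiniteDimensional.complete ℂ H
  have hN := hE.card_pos
  have hcomp (k : κ) : negEntropy (fun j => (M k).reApplyInnerSelf (ψ j)) ≤
      c * ∑ j, (M k).reApplyInnerSelf (ψ j) + μ * (M k).reApplyInnerSelf (∑ j, ψ j) := by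
    obtain ⟨B, hB⟩ := CStarAlgebra.nonneg_iff_eq_star_mul_self.1
      ((M k).nonneg_iff_isPositive.2 (hM.1 k))
    have hform (x : H) : (M k).reApplyInnerSelf x = ‖B x‖ ^ 2 := by
      rw [hB]
      exact (B.apply_norm_sq_eq_inner_adjoint_left x).symm
    simpa only [hform, quadMajorant, map_sum] using hle B
  rw [hE.mutualInfo_eq hM]
  have hsum := Finset.sum_le_sum fun k (_ : k ∈ Finset.univ) => hcomp k
  rw [hE.sum_quadMajorant_form hM] at hsum
  rw [show (c + μ * (‖∑ j, ψ j‖ ^ 2 / Fintype.card ι)) / log 2 =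
    (c * Fintype.card ι + μ * ‖∑ j, ψ j‖ ^ 2) / (Fintype.card ι * log 2) by field_simp]
  gcongr

lemma mutualInfo_eq_of_negEntropy_eq (hE : IsEquiprobablePure E ψ) (hM : IsObservable M) {c μ : ℝ}
    {a : κ → ℝ} {v : κ → H} (hMv : ∀ k, M k = (a k : ℂ) • rankOne ℂ (v k) (v k))
    (heq : ∀ k, a k ≠ 0 → negEntropy (fun j => ‖inner ℂ (v k) (ψ j)‖ ^ 2) =
      quadMajorant c μ fun j => inner ℂ (v k) (ψ j)) :
    mutualInfo E M = logb 2 (Fintype.card ι) +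
      (c + μ * (‖∑ j, ψ j‖ ^ 2 / Fintype.card ι)) / log 2 := by
  have hN := hE.card_pos
  have hcomp (k : κ) : negEntropy (fun j => (M k).reApplyInnerSelf (ψ j)) =
      c * ∑ j, (M k).reApplyInnerSelf (ψ j) + μ * (M k).reApplyInnerSelf (∑ j, ψ j) := by
    have hsmul : (fun j => a k * ‖inner ℂ (v k) (ψ j)‖ ^ 2) =
        a k • fun j => ‖inner ℂ (v k) (ψ j)‖ ^ 2 := rfl
    simp only [hMv k, reApplyInnerSelf_ofReal_smul_rankOne, hsmul, negEntropy_smul,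
      ← Finset.mul_sum, inner_sum]
    rcases eq_or_ne (a k) 0 with ha | ha
    · simp [ha]
    · rw [heq k ha, quadMajorant]
      ring
  rw [hE.mutualInfo_eq hM, Finset.sum_congr rfl fun k _ => hcomp k, hE.sum_quadMajorant_form hM]
  field_simp

lemma bddAbove_infoValues (hE : IsEquiprobablePure E ψ) : BddAbove (infoValues E) := by
  refine ⟨logb 2 (Fintype.card ι) + (0 + 0 * (‖∑ j, ψ j‖ ^ 2 / Fintype.card ι)) / log 2, ?_⟩
  rintro _ ⟨n, N, hN, rfl⟩
  refine hE.mutualInfo_le_of_negEntropy_le hN fun B => ?_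
  simpa [quadMajorant] using negEntropy_nonpos fun j => sq_nonneg ‖B (ψ j)‖

theorem isInfoOptimal_and_mutualInfo_eq (hE : IsEquiprobablePure E ψ) (hM : IsObservable M)
    {N β : ℝ} (hN : Fintype.card ι = N) (hN2 : 2 ≤ N) (hβ : 0 ≤ β) (hNβ : (N - 1) * β ≤ 1)
    (hcoef : -log 2 ≤ constCoef (N - 1) β) (hflat : (N - 1) * β = 1 → ∑ j, ψ j = 0)
    {a : κ → ℝ} {v : κ → H} (hMv : ∀ k, M k = (a k : ℂ) • rankOne ℂ (v k) (v k))
    (heq : ∀ k, a k ≠ 0 → negEntropy (fun j => ‖inner ℂ (v k) (ψ j)‖ ^ 2) =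
      quadMajorant (constCoef (N - 1) β) (sumCoef (N - 1) β) fun j => inner ℂ (v k) (ψ j)) :
    IsInfoOptimal E M ∧ mutualInfo E M = infoBound N (‖∑ j, ψ j‖ ^ 2 / N) β := by
  have hvalue := hE.mutualInfo_eq_of_negEntropy_eq hM hMv heq
  subst hN
  refine ⟨⟨hM, fun n M' hM' => ?_⟩, hvalue⟩
  rw [hvalue]
  refine hE.mutualInfo_le_of_negEntropy_le hM' fun B => ?_
  let _ : InnerProductSpace ℝ H := InnerProductSpace.complexToReal
  refine negEntropy_le_quadMajorant (by ring) (by linarith) hβ hNβ hcoef fun h => ?_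
  rw [← map_sum, hflat h, map_zero]

end IsEquiprobablePure

end Ensemble

/-! ### The numerical parameters of the pyramid -/

section EdgeRatio

variable {m : ℕ} {τ τ' : ℝ}

/-- The number `β` for which the amplitudes of the edges along `etilde e t k` are proportional to
`(1, -β, …, -β)`, where `τ = t √(r₀ / r₁)`. For `t = 1` it is `-b / a`. -/
def edgeRatio (m : ℕ) (τ : ℝ) : ℝ := (1 - τ) / (m - 1 + τ)

lemma one_le_natCast_sub_one (hm : 2 ≤ m) : 1 ≤ (m : ℝ) - 1 := by
  have : (2 : ℝ) ≤ m := Nat.ofNat_le_cast.2 hm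
  linarith

lemma natCast_sub_one_add_pos (hm : 2 ≤ m) (hτ : 0 ≤ τ) : 0 < (m : ℝ) - 1 + τ := by
  linarith [one_le_natCast_sub_one hm]

lemma one_add_edgeRatio (h : 0 < (m : ℝ) - 1 + τ) : 1 + edgeRatio m τ = m / (m - 1 + τ) := by
  rw [edgeRatio]
  field_simp
  ring

lemma one_sub_mul_edgeRatio (h : 0 < (m : ℝ) - 1 + τ) :
    1 - (m - 1) * edgeRatio m τ = m * τ / (m - 1 + τ) := by
  rw [edgeRatio]
  field_simp
  ring

lemma one_add_mul_edgeRatio_sq (h : 0 < (m : ℝ) - 1 + τ) :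
    1 + (m - 1) * edgeRatio m τ ^ 2 = m * (m - 1 + τ ^ 2) / (m - 1 + τ) ^ 2 := by
  rw [edgeRatio]
  field_simp
  ring

lemma edgeRatio_nonneg (h : 0 < (m : ℝ) - 1 + τ) (hτ : τ ≤ 1) : 0 ≤ edgeRatio m τ :=
  div_nonneg (sub_nonneg.2 hτ) h.le

lemma edgeRatio_pos (h : 0 < (m : ℝ) - 1 + τ) (hτ : τ < 1) : 0 < edgeRatio m τ :=
  div_pos (sub_pos.2 hτ) h

lemma mul_edgeRatio_le_one (hm : 2 ≤ m) (hτ : 0 ≤ τ) : (m - 1) * edgeRatio m τ ≤ 1 := by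
  have h := natCast_sub_one_add_pos hm hτ
  rw [← sub_nonneg, one_sub_mul_edgeRatio h]
  positivity

lemma mul_edgeRatio_lt_one (hm : 2 ≤ m) (hτ : 0 < τ) : (m - 1) * edgeRatio m τ < 1 := by
  have h := natCast_sub_one_add_pos hm hτ.le
  rw [← sub_pos, one_sub_mul_edgeRatio h]
  positivity

lemma edgeRatio_lt_edgeRatio_iff (hm : m ≠ 0) (h : 0 < (m : ℝ) - 1 + τ)
    (h' : 0 < (m : ℝ) - 1 + τ') : edgeRatio m τ < edgeRatio m τ' ↔ τ' < τ := by
  have hm0 : (0 : ℝ) < m := by positivity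
  rw [edgeRatio, edgeRatio, div_lt_div_iff₀ h h']
  constructor <;> intro hlt <;> nlinarith

lemma inv_one_add_mul_edgeRatio_sq_le_iff (hm : 2 ≤ m) (h : 0 < (m : ℝ) - 1 + τ)
    (h' : 0 < (m : ℝ) - 1 + τ') (hτ : τ ≤ 1) (hτ' : τ' ≤ 1) :
    (1 + (m - 1) * edgeRatio m τ ^ 2)⁻¹ ≤ (1 + (m - 1) * edgeRatio m τ' ^ 2)⁻¹ ↔ τ ≤ τ' := by
  have hn : 0 < (m : ℝ) - 1 := zero_lt_one.trans_le (one_le_natCast_sub_one hm)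
  rw [inv_le_inv₀ (by positivity) (by positivity), add_le_add_iff_left, mul_le_mul_iff_right₀ hn,
    pow_le_pow_iff_left₀ (edgeRatio_nonneg h' hτ') (edgeRatio_nonneg h hτ) two_ne_zero,
    ← not_lt, edgeRatio_lt_edgeRatio_iff (by omega) h h', not_lt]

lemma edgeRatio_mul_log_edgeRatio (h : 0 < (m : ℝ) - 1 + τ) (hτ : τ ≤ 1) :
    edgeRatio m τ * log (edgeRatio m τ) =
      edgeRatio m τ * (log (1 - τ) - log (m - 1 + τ)) := by
  rcases hτ.eq_or_lt with rfl | hτ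
  · simp [edgeRatio]
  · conv_lhs => rw [edgeRatio, log_div (sub_pos.2 hτ).ne' h.ne', ← edgeRatio]

lemma sub_one_add_sq_pos (hm : 2 ≤ m) (τ : ℝ) : 0 < (m : ℝ) - 1 + τ ^ 2 :=
  natCast_sub_one_add_pos hm (sq_nonneg τ)

lemma constCoef_edgeRatio (hm : 2 ≤ m) (h : 0 < (m : ℝ) - 1 + τ) (hτ : τ ≤ 1) :
    constCoef (m - 1) (edgeRatio m τ) = -(gObt m τ + 1) * log 2 := by
  have hlog2 : log 2 ≠ 0 := (log_pos one_lt_two).ne'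
  have hm0 : (m : ℝ) ≠ 0 := by positivity
  have hq := sub_one_add_sq_pos hm τ
  rw [constCoef, one_add_mul_edgeRatio_sq h, one_add_edgeRatio h, edgeRatio_mul_log_edgeRatio h hτ,
    log_div (by positivity) (by positivity), log_mul hm0 hq.ne', log_pow, gObt, edgeRatio]
  simp only [logb, log_pow, log_div (mul_ne_zero hm0 hq.ne') two_ne_zero, log_mul hm0 hq.ne']
  field_simp
  push_cast
  ring

lemma sumCoef_edgeRatio (hm : 2 ≤ m) (hτ0 : 0 < τ) (hτ1 : τ ≤ 1) :
    sumCoef (m - 1) (edgeRatio m τ) =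
      2 * (1 - τ) * (m - 1 + τ) * (log (m - 1 + τ) - log (1 - τ)) / (m ^ 2 * τ) := by
  have h := natCast_sub_one_add_pos hm hτ0.le
  have hm0 : (m : ℝ) ≠ 0 := by positivity
  rw [sumCoef, one_add_edgeRatio h, one_sub_mul_edgeRatio h, edgeRatio_mul_log_edgeRatio h hτ1,
    edgeRatio]
  field_simp
  ring

end EdgeRatio

section CriticalParameter

variable {m : ℕ} {τ : ℝ}

lemma strictAntiOn_gObt (hm : 2 ≤ m) : StrictAntiOn (gObt m) (Set.Icc 0 1) := by
  intro τ hτ τ' hτ' hlt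
  have h := natCast_sub_one_add_pos hm hτ.1
  have h' := natCast_sub_one_add_pos hm hτ'.1
  have hmem : ∀ t ∈ Set.Icc (0 : ℝ) 1, edgeRatio m t ∈ Set.Icc 0 (1 / ((m : ℝ) - 1)) :=
    fun t ht => ⟨edgeRatio_nonneg (natCast_sub_one_add_pos hm ht.1) ht.2,
      (le_div_iff₀' (by linarith [one_le_natCast_sub_one hm])).2 (mul_edgeRatio_le_one hm ht.1)⟩
  have hcoef := constCoef_strictAntiOn (one_le_natCast_sub_one hm) (hmem τ' hτ') (hmem τ hτ)
    ((edgeRatio_lt_edgeRatio_iff (by omega) h' h).2 hlt)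
  rw [constCoef_edgeRatio hm h hτ.2, constCoef_edgeRatio hm h' hτ'.2,
    mul_lt_mul_iff_left₀ (log_pos one_lt_two)] at hcoef
  linarith

lemma continuous_gObt (hm : 2 ≤ m) : Continuous (gObt m) := by
  have hmul : Continuous fun x : ℝ => x / m * logb 2 (x ^ 2) := by
    have heq : (fun x : ℝ => x / m * logb 2 (x ^ 2)) = fun x => 2 / (m * log 2) * (x * log x) := by
      funext x
      rw [logb, log_pow]
      push_cast
      field_simp
    rw [heq]
    exact continuous_mul_log.const_mul _
  have hq (x : ℝ) : (m : ℝ) * (m - 1 + x ^ 2) / 2 ≠ 0 := by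
    have := sub_one_add_sq_pos hm x
    positivity
  unfold gObt
  refine ((Continuous.div_const (Continuous.log (by fun_prop) hq) _).sub
    (hmul.comp (by fun_prop : Continuous fun τ : ℝ => (m : ℝ) - 1 + τ))).sub
    (hmul.comp (by fun_prop : Continuous fun τ : ℝ => 1 - τ))

lemma gObt_one (hm : m ≠ 0) : gObt m 1 = -1 := by
  have hm0 : (m : ℝ) ≠ 0 := Nat.cast_ne_zero.2 hm
  have hmm : (m : ℝ) * (m - 1 + 1 ^ 2) / 2 = m ^ 2 / 2 := by ring
  rw [gObt, hmm, sub_add_cancel, sub_self, div_self hm0, logb_div (by positivity) two_ne_zero,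
    logb_self_eq_one one_lt_two]
  ring

lemma gObt_zero_mul (hm : 2 ≤ m) :
    gObt m 0 * (m * log 2) = log (m ^ m) - log (2 ^ m * (m - 1) ^ (m - 2)) := by
  have hlog2 : log 2 ≠ 0 := (log_pos one_lt_two).ne'
  have hn : (m : ℝ) - 1 ≠ 0 := by linarith [one_le_natCast_sub_one hm]
  have hm0 : (m : ℝ) ≠ 0 := by positivity
  rw [log_mul (by positivity) (by positivity), log_pow, log_pow, log_pow, Nat.cast_sub hm, gObt]
  simp only [logb, zero_pow two_ne_zero, add_zero, sub_zero, one_pow, log_one, zero_div, mul_zero,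
    log_div (mul_ne_zero hm0 hn) two_ne_zero, log_mul hm0 hn, log_pow]
  field_simp
  push_cast
  ring

lemma gObt_zero_nonneg (hm : 2 ≤ m) (hm6 : m ≤ 6) : 0 ≤ gObt m 0 := by
  have hn : 0 < (m : ℝ) - 1 := by linarith [one_le_natCast_sub_one hm]
  have hpow : (2 : ℝ) ^ m * ((m : ℝ) - 1) ^ (m - 2) ≤ (m : ℝ) ^ m := by
    interval_cases m <;> norm_num
  have hlog := sub_nonneg.2 (log_le_log (by positivity) hpow)
  rw [← gObt_zero_mul hm] at hlog
  exact nonneg_of_mul_nonneg_left hlog (by positivity)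

lemma succ_pow_succ_lt {n : ℕ} (hn : 6 ≤ n) :
    (n + 1) ^ (n + 1) < 2 ^ (n + 1) * n ^ (n - 1) := by
  induction n, hn using Nat.le_induction with
  | base => norm_num
  | succ n hn ih =>
    obtain ⟨k, rfl⟩ : ∃ k, n = k + 1 := ⟨n - 1, by omega⟩
    simp only [Nat.add_sub_cancel] at ih ⊢
    have hmid : ((k + 1) * (k + 3)) ^ k ≤ ((k + 2) ^ 2) ^ k :=
      Nat.pow_le_pow_left (by nlinarith) k
    have hcube : (k + 3) ^ 3 ≤ 2 * (k + 2) ^ 3 := by nlinarith [sq_nonneg k]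
    refine lt_of_mul_lt_mul_right (a := (k + 1) ^ k) ?_ (Nat.zero_le _)
    calc (k + 1 + 1 + 1) ^ (k + 1 + 1 + 1) * (k + 1) ^ k
        = (k + 3) ^ 3 * ((k + 1) * (k + 3)) ^ k := by
          rw [mul_pow]
          ring
      _ ≤ (2 * (k + 2) ^ 3) * ((k + 2) ^ 2) ^ k := Nat.mul_le_mul hcube hmid
      _ = 2 * (k + 2) ^ (k + 1) * (k + 2) ^ (k + 2) := by
          rw [← pow_mul]
          ring
      _ < 2 * (k + 2) ^ (k + 1) * (2 ^ (k + 2) * (k + 1) ^ k) :=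
          Nat.mul_lt_mul_of_pos_left ih (by positivity)
      _ = _ := by ring

lemma gObt_zero_neg (hm : 7 ≤ m) : gObt m 0 < 0 := by
  have hpow : (m : ℝ) ^ m < (2 : ℝ) ^ m * ((m : ℝ) - 1) ^ (m - 2) := by
    obtain ⟨n, rfl⟩ : ∃ n, m = n + 1 := ⟨m - 1, by omega⟩
    have hlt := succ_pow_succ_lt (n := n) (by omega)
    rw [Nat.cast_succ, add_sub_cancel_right, show n + 1 - 2 = n - 1 by omega]
    exact_mod_cast hlt
  have hlog := sub_neg.2 (log_lt_log (by positivity) hpow)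
  rw [← gObt_zero_mul (by omega)] at hlog
  exact neg_of_mul_neg_left hlog (by positivity)

lemma gObt_one_sub_pos (hm : 4 ≤ m) : 0 < gObt m (1 - m) := by
  have hm4 : (4 : ℝ) ≤ m := Nat.ofNat_le_cast.2 hm
  have hm0 : (m : ℝ) ≠ 0 := by positivity
  have hfirst : (m : ℝ) * (m - 1 + (1 - m) ^ 2) / 2 = (m : ℝ) ^ 2 * ((m - 1) / 2) := by ring
  have hvalue : gObt m (1 - m) = logb 2 (((m : ℝ) - 1) / 2) := by
    rw [gObt, hfirst, sub_sub_cancel, sub_add_sub_cancel, sub_self, div_self hm0,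
      logb_mul (by positivity) (by linarith)]
    ring
  rw [hvalue]
  exact logb_pos one_lt_two (by linarith)

lemma exists_gObt_eq_zero_of_le_six (hm : 2 ≤ m) (hm6 : m ≤ 6) :
    ∃ τ ∈ Set.Icc (0 : ℝ) 1, gObt m τ = 0 :=
  intermediate_value_Icc' zero_le_one (continuous_gObt hm).continuousOn
    ⟨by rw [gObt_one (by omega)]; norm_num, gObt_zero_nonneg hm hm6⟩

lemma exists_gObt_eq_zero_of_seven_le (hm : 7 ≤ m) :
    ∃ τ ∈ Set.Ioo (1 - (m : ℝ)) 0, gObt m τ = 0 :=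
  intermediate_value_Ioo' (by linarith [one_le_natCast_sub_one (m := m) (by omega)])
    (continuous_gObt (by omega)).continuousOn ⟨gObt_zero_neg hm, gObt_one_sub_pos (by omega)⟩

lemma isGreatest_tauObt (hm : 2 ≤ m) :
    IsGreatest {τ : ℝ | τ ≤ 1 ∧ gObt m τ = 0} (tauObt m) := by
  have hclosed : IsClosed {τ : ℝ | τ ≤ 1 ∧ gObt m τ = 0} :=
    isClosed_Iic.inter (isClosed_eq (continuous_gObt hm) continuous_const)
  have hbdd : BddAbove {τ : ℝ | τ ≤ 1 ∧ gObt m τ = 0} := ⟨1, fun _ h => h.1⟩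
  refine ⟨hclosed.csSup_mem ?_ hbdd, fun τ h => le_csSup hbdd h⟩
  rcases Nat.lt_or_ge 6 m with hm6 | hm6
  · obtain ⟨τ, hτ, hg⟩ := exists_gObt_eq_zero_of_seven_le hm6
    exact ⟨τ, hτ.2.le.trans zero_le_one, hg⟩
  · obtain ⟨τ, hτ, hg⟩ := exists_gObt_eq_zero_of_le_six hm hm6
    exact ⟨τ, hτ.2, hg⟩

lemma gObt_tauObt (hm : 2 ≤ m) : gObt m (tauObt m) = 0 := (isGreatest_tauObt hm).1.2

lemma tauObt_lt_one (hm : 2 ≤ m) : tauObt m < 1 := by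
  refine (isGreatest_tauObt hm).1.1.lt_of_ne fun h => ?_
  have hzero := gObt_tauObt hm
  rw [h, gObt_one (by omega)] at hzero
  norm_num at hzero

lemma tauObt_nonneg (hm : 2 ≤ m) (hm6 : m ≤ 6) : 0 ≤ tauObt m := by
  obtain ⟨τ, hτ, hg⟩ := exists_gObt_eq_zero_of_le_six hm hm6
  exact hτ.1.trans ((isGreatest_tauObt hm).2 ⟨hτ.2, hg⟩)

lemma setOf_gObt_eq_zero (hm : 2 ≤ m) (hm6 : m ≤ 6) :
    {τ : ℝ | τ ∈ Set.Icc 0 1 ∧ gObt m τ = 0} = {tauObt m} := by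
  have hmem : tauObt m ∈ Set.Icc 0 1 := ⟨tauObt_nonneg hm hm6, (tauObt_lt_one hm).le⟩
  refine Set.eq_singleton_iff_unique_mem.2 ⟨⟨hmem, gObt_tauObt hm⟩, fun τ hτ => ?_⟩
  exact (strictAntiOn_gObt hm).injOn hτ.1 hmem (hτ.2.trans (gObt_tauObt hm).symm)

lemma tauObt_neg (hm : 7 ≤ m) : tauObt m < 0 := by
  have hm2 : 2 ≤ m := by omega
  by_contra! hnonneg
  have hle := (strictAntiOn_gObt hm2).antitoneOn ⟨le_rfl, zero_le_one⟩
    ⟨hnonneg, (tauObt_lt_one hm2).le⟩ hnonneg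
  exact (gObt_zero_neg hm).not_ge ((gObt_tauObt hm2).ge.trans hle)

lemma sub_one_add_tauObt_pos (hm : 2 ≤ m) : 0 < (m : ℝ) - 1 + tauObt m := by
  rcases Nat.lt_or_ge 6 m with hm6 | hm6
  · obtain ⟨τ, hτ, hg⟩ := exists_gObt_eq_zero_of_seven_le hm6
    linarith [hτ.1, (isGreatest_tauObt hm).2 ⟨hτ.2.le.trans zero_le_one, hg⟩]
  · exact natCast_sub_one_add_pos hm (tauObt_nonneg hm hm6)

lemma constCoef_edgeRatio_tauObt (hm : 2 ≤ m) :
    constCoef (m - 1) (edgeRatio m (tauObt m)) = -log 2 := by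
  rw [constCoef_edgeRatio hm (sub_one_add_tauObt_pos hm) (tauObt_lt_one hm).le, gObt_tauObt hm,
    zero_add, neg_mul, one_mul]

lemma gObt_nonpos_of_tauObt_le (hm : 2 ≤ m) (h : tauObt m ≤ τ) (hτ : τ ≤ 1) : gObt m τ ≤ 0 := by
  by_contra! hpos
  obtain ⟨τ', hτ', hg⟩ := intermediate_value_Icc' hτ (continuous_gObt hm).continuousOn
    ⟨by rw [gObt_one (by omega)]; norm_num, hpos.le⟩
  have heq : τ' = τ := (((isGreatest_tauObt hm).2 ⟨hτ'.2, hg⟩).trans h).antisymm hτ'.1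
  exact hpos.ne' (heq ▸ hg)

lemma pObt_eq (hm : 2 ≤ m) : pObt m = (1 + (m - 1) * edgeRatio m (tauObt m) ^ 2)⁻¹ := by
  have hsub : 0 < 1 - tauObt m := sub_pos.2 (tauObt_lt_one hm)
  have hinv : 1 - (m : ℝ) / (1 - tauObt m) = -(edgeRatio m (tauObt m))⁻¹ := by
    rw [edgeRatio]
    field_simp
    ring
  rw [pObt, hinv, neg_sq, inv_pow, inv_inv]

lemma pObt_lt (hm : 7 ≤ m) : pObt m < ((m : ℝ) - 1) / m := by
  have hm2 : 2 ≤ m := by omega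
  have hn := one_le_natCast_sub_one hm2
  have hpos := sub_one_add_tauObt_pos hm2
  have hβ : 1 < ((m : ℝ) - 1) * edgeRatio m (tauObt m) := by
    rw [← sub_neg, one_sub_mul_edgeRatio hpos]
    exact div_neg_of_neg_of_pos (mul_neg_of_pos_of_neg (by linarith) (tauObt_neg hm)) hpos
  rw [pObt_eq hm2, lt_div_iff₀ (by linarith), inv_mul_lt_iff₀ (by positivity)]
  nlinarith

end CriticalParameter

/-! ### Quantum pyramids and the extremal observables -/

section Pyramid

open InnerProductSpace (rankOne isPositive_rankOne_self)

variable {m : ℕ} {H : Type*} [NormedAddCommGroup H] [InnerProductSpace ℂ H]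
  (e : OrthonormalBasis (Fin m) ℂ H)

lemma ofReal_sqrt_mul_self_natCast (n : ℕ) : ((√(n : ℝ) : ℝ) : ℂ) * ((√(n : ℝ) : ℝ) : ℂ) = n := by
  rw [← Complex.ofReal_mul, mul_self_sqrt n.cast_nonneg, Complex.ofReal_natCast]

lemma sum_basis_eq_smul_axis : ∑ j, e j = ((√(m : ℝ) : ℝ) : ℂ) • axis e := by
  rcases m.eq_zero_or_pos with rfl | hm
  · simp
  have hsqrt : √(m : ℝ) ≠ 0 := (sqrt_pos.2 (Nat.cast_pos.2 hm)).ne'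
  rw [axis, smul_smul, ← Complex.ofReal_mul, mul_one_div_cancel hsqrt, Complex.ofReal_one,
    one_smul]

lemma sum_edge (r0 r1 : ℝ) : ∑ j, edge e r0 r1 j = ((m * √r0 : ℝ) : ℂ) • axis e := by
  simp only [edge, Finset.sum_add_distrib, ← Finset.smul_sum, sum_basis_eq_smul_axis,
    Finset.sum_const, Finset.card_univ, Fintype.card_fin, ← Nat.cast_smul_eq_nsmul ℂ, smul_smul,
    ← add_smul]
  congr 1
  norm_cast
  rw [sqrt_mul m.cast_nonneg]
  linear_combination √r1 * mul_self_sqrt (m.cast_nonneg (α := ℝ))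

variable {e} in
lemma norm_axis (hm : 2 ≤ m) : ‖axis e‖ = 1 := by
  rw [← pow_eq_one_iff_of_nonneg (norm_nonneg _) two_ne_zero, ← inner_self_eq_norm_sq (𝕜 := ℂ),
    inner_axis_axis e hm, RCLike.one_re]

lemma norm_sum_edge_sq (hm : 2 ≤ m) {r0 : ℝ} (hr0 : 0 ≤ r0) (r1 : ℝ) :
    ‖∑ j, edge e r0 r1 j‖ ^ 2 = m ^ 2 * r0 := by
  rw [sum_edge, norm_smul, norm_axis hm, mul_one, Complex.norm_real, norm_eq_abs, sq_abs, mul_pow,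
    sq_sqrt hr0]

lemma inner_axis_edge (hm : 2 ≤ m) (r0 r1 : ℝ) (j : Fin m) :
    inner ℂ (axis e) (edge e r0 r1 j) = ((√r0 : ℝ) : ℂ) := by
  have hsqrt : √(m : ℝ) ≠ 0 := (sqrt_pos.2 (by positivity)).ne'
  rw [edge, inner_add_right, inner_smul_right, inner_smul_right, inner_axis_axis e hm,
    ← inner_conj_symm, inner_basis_axis, Complex.conj_ofReal, sqrt_mul m.cast_nonneg]
  norm_cast
  field_simp
  ring

lemma inner_basis_edge (r0 r1 : ℝ) (j k : Fin m) :
    inner ℂ (e k) (edge e r0 r1 j) =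
      (((if j = k then √(m * r1) else 0) + (√r0 - √r1) / √(m : ℝ) : ℝ) : ℂ) := by
  rw [edge, inner_add_right, inner_smul_right, inner_smul_right, inner_basis_axis,
    e.inner_eq_ite]
  split_ifs with hkj hjk hjk
  · push_cast
    ring
  · exact absurd hkj.symm hjk
  · exact absurd hjk.symm hkj
  · push_cast
    ring

lemma inner_etilde_edge (hm : 2 ≤ m) (r0 r1 t : ℝ) (j k : Fin m) :
    inner ℂ (etilde e t k) (edge e r0 r1 j) =
      (((if j = k then √(m * r1) else 0) + (t * √r0 - √r1) / √(m : ℝ) : ℝ) : ℂ) := by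
  rw [etilde, inner_add_left, inner_smul_left, Complex.conj_ofReal, inner_basis_edge,
    inner_axis_edge e hm]
  push_cast
  ring

lemma inner_diffVec_edge (r0 r1 : ℝ) (j r s : Fin m) :
    inner ℂ (diffVec e r s) (edge e r0 r1 j) =
      (((if j = r then √(m * r1) else 0) - (if j = s then √(m * r1) else 0) : ℝ) / √2 : ℂ) := by
  rw [diffVec, inner_smul_left, Complex.conj_ofReal, inner_sub_left, inner_basis_edge,
    inner_basis_edge]
  push_cast
  ring

lemma inner_etilde_edge_eq_neg_smul (hm : 2 ≤ m) {r0 r1 t τ : ℝ} (ht : t * √r0 = τ * √r1)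
    (hτ : 0 ≤ τ) (k j : Fin m) (hj : j ≠ k) :
    inner ℂ (etilde e t k) (edge e r0 r1 j) =
      -(edgeRatio m τ • inner ℂ (etilde e t k) (edge e r0 r1 k)) := by
  have hsqrt : √(m : ℝ) ≠ 0 := (sqrt_pos.2 (by positivity)).ne'
  have hne : (m : ℝ) - 1 + τ ≠ 0 := (natCast_sub_one_add_pos hm hτ).ne'
  rw [inner_etilde_edge e hm, inner_etilde_edge e hm, if_neg hj, if_pos rfl, ht,
    sqrt_mul m.cast_nonneg, edgeRatio, Complex.real_smul, ← Complex.ofReal_mul,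
    ← Complex.ofReal_neg]
  congr 1
  field_simp
  rw [sq_sqrt m.cast_nonneg]
  ring

lemma sum_rankOne_etilde (hm : m ≠ 0) (t : ℝ) :
    ∑ k, rankOne ℂ (etilde e t k) (etilde e t k) =
      ContinuousLinearMap.id ℂ H + ((t ^ 2 - 1 : ℝ) : ℂ) • rankOne ℂ (axis e) (axis e) := by
  have hsqrt : √(m : ℝ) ≠ 0 := (sqrt_pos.2 (by positivity)).ne'
  simp only [etilde, map_add, map_smul, map_smulₛₗ, _root_.add_apply, _root_.smul_apply,
    Finset.sum_add_distrib, ← Finset.smul_sum, ← map_sum, ← _root_.sum_apply,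
    OrthonormalBasis.sum_rankOne_eq_id, sum_basis_eq_smul_axis, Complex.conj_ofReal,
    Finset.sum_const, Finset.card_univ, Fintype.card_fin, ← Nat.cast_smul_eq_nsmul ℂ, smul_smul,
    map_natCast]
  have hcoef : (((t - 1) / √(m : ℝ) : ℝ) : ℂ) * ((√(m : ℝ) : ℝ) : ℂ) = t - 1 := by
    rw [← Complex.ofReal_mul, div_mul_cancel₀ _ hsqrt]
    push_cast
    rfl
  rw [← ofReal_sqrt_mul_self_natCast m, add_assoc, smul_add, smul_smul, smul_smul, ← add_smul,
    ← add_smul]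
  congr 2
  push_cast at hcoef ⊢
  linear_combination (2 + ((t - 1) / √(m : ℝ) : ℂ) * √(m : ℝ) + (t - 1)) * hcoef

lemma two_nsmul_sum_lt_eq_sum_sum {ι A : Type*} [Fintype ι] [LinearOrder ι] [AddCommMonoid A]
    {f : ι → ι → A} (hsymm : ∀ i j, f i j = f j i) (hdiag : ∀ i, f i i = 0) :
    2 • ∑ q : {q : ι × ι // q.1 < q.2}, f q.1.1 q.1.2 = ∑ i, ∑ j, f i j := by
  have hlt : ∑ q : {q : ι × ι // q.1 < q.2}, f q.1.1 q.1.2 =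
      ∑ i, ∑ j, if i < j then f i j else 0 := by
    rw [← Fintype.sum_prod_type' (f := fun i j => if i < j then f i j else 0), ← Finset.sum_filter]
    exact (Finset.sum_subtype _ (by simp) fun q : ι × ι => f q.1 q.2).symm
  have hgt : ∑ i, ∑ j, (if i < j then f i j else 0) = ∑ i, ∑ j, if j < i then f i j else 0 := by
    rw [Finset.sum_comm]
    simp only [hsymm]
  rw [two_nsmul, hlt]
  nth_rewrite 2 [hgt]
  simp only [← Finset.sum_add_distrib]
  refine Finset.sum_congr rfl fun i _ => Finset.sum_congr rfl fun j _ => ?_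
  rcases lt_trichotomy i j with hij | rfl | hij
  · simp [hij, hij.not_gt]
  · simp [hdiag]
  · simp [hij, hij.not_gt]

lemma sum_sum_rankOne_sub :
    ∑ r, ∑ s, rankOne ℂ (e r - e s) (e r - e s) =
      (2 * m : ℂ) • (ContinuousLinearMap.id ℂ H - rankOne ℂ (axis e) (axis e)) := by
  simp only [map_sub, _root_.sub_apply, Finset.sum_sub_distrib, Finset.sum_const,
    Finset.card_univ, Fintype.card_fin, ← map_sum, ← _root_.sum_apply, map_smul, map_smulₛₗ,
    _root_.smul_apply, ← Finset.smul_sum, OrthonormalBasis.sum_rankOne_eq_id,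
    sum_basis_eq_smul_axis, Complex.conj_ofReal, smul_smul, ofReal_sqrt_mul_self_natCast]
  module

lemma rankOne_diffVec (r s : Fin m) :
    rankOne ℂ (diffVec e r s) (diffVec e r s) =
      (1 / 2 : ℂ) • rankOne ℂ (e r - e s) (e r - e s) := by
  have hhalf : ((1 / √2 : ℝ) : ℂ) * ((1 / √2 : ℝ) : ℂ) = 1 / 2 := by
    rw [← Complex.ofReal_mul, div_mul_div_comm, mul_self_sqrt zero_le_two]
    norm_num
  simp only [diffVec, map_smul, map_smulₛₗ, _root_.smul_apply, Complex.conj_ofReal, smul_smul,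
    hhalf]

lemma sum_rankOne_diffVec :
    ∑ q : {q : Fin m × Fin m // q.1 < q.2},
      rankOne ℂ (diffVec e q.1.1 q.1.2) (diffVec e q.1.1 q.1.2) =
      ((m / 2 : ℝ) : ℂ) • (ContinuousLinearMap.id ℂ H - rankOne ℂ (axis e) (axis e)) := by
  have htwice := two_nsmul_sum_lt_eq_sum_sum (f := fun r s => rankOne ℂ (e r - e s) (e r - e s))
    (fun r s => by simp only [← neg_sub (e s) (e r), map_neg, _root_.neg_apply, neg_neg])
    fun r => by simp only [sub_self, map_zero]
  rw [sum_sum_rankOne_sub, ← Nat.cast_smul_eq_nsmul ℂ] at htwice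
  simp only [rankOne_diffVec, ← Finset.smul_sum]
  have htwo : (((2 : ℕ) : ℂ)) ≠ 0 := by norm_num
  rw [← eq_inv_smul_iff₀ htwo] at htwice
  rw [htwice]
  push_cast
  module

lemma isPositive_ofReal_smul_rankOne {a : ℝ} (ha : 0 ≤ a) (v : H) :
    ((a : ℂ) • rankOne ℂ v v).IsPositive :=
  (isPositive_rankOne_self v).smul_of_nonneg (Complex.zero_le_real.2 ha)

lemma isObservable_pyramidObservable (hm : m ≠ 0) {t : ℝ} (ht : 1 ≤ t) :
    IsObservable (pyramidObservable e t) := by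
  have hinv : (t ^ 2)⁻¹ ≤ 1 := inv_le_one_of_one_le₀ (one_le_pow₀ ht)
  have ht2 : (t : ℂ) ≠ 0 := Complex.ofReal_ne_zero.2 (by linarith)
  have hmC : (m : ℂ) ≠ 0 := Nat.cast_ne_zero.2 hm
  constructor
  · rintro (k | q)
    · exact isPositive_ofReal_smul_rankOne (by positivity) _
    · exact isPositive_ofReal_smul_rankOne (mul_nonneg (by positivity) (sub_nonneg.2 hinv)) _
  · simp only [Fintype.sum_sum_type, pyramidObservable, ← Finset.smul_sum,
      sum_rankOne_etilde e hm, sum_rankOne_diffVec, smul_add, smul_sub, smul_smul]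
    push_cast
    match_scalars <;> field_simp <;> ring

/-- The limit of the observables `pyramidObservable e t` as `t → ∞`, which is optimal for the flat
pyramid `r₀ = 0`. The outcome `none` is the projection on the axis. -/
def flatObservable (e : OrthonormalBasis (Fin m) ℂ H) :
    Option {q : Fin m × Fin m // q.1 < q.2} → H →L[ℂ] H
  | none => rankOne ℂ (axis e) (axis e)
  | some q => ((2 / m : ℝ) : ℂ) • rankOne ℂ (diffVec e q.1.1 q.1.2) (diffVec e q.1.1 q.1.2)

lemma isObservable_flatObservable (hm : m ≠ 0) : IsObservable (flatObservable e) := by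
  have hmC : (m : ℂ) ≠ 0 := Nat.cast_ne_zero.2 hm
  constructor
  · rintro (_ | q)
    · exact isPositive_rankOne_self _
    · exact isPositive_ofReal_smul_rankOne (by positivity) _
  · simp only [Fintype.sum_option, flatObservable, ← Finset.smul_sum, sum_rankOne_diffVec,
      smul_sub, smul_smul]
    push_cast
    match_scalars <;> field_simp
    ring

lemma negEntropy_inner_etilde_edge (hm : 2 ≤ m) {r0 r1 t τ : ℝ} (ht : t * √r0 = τ * √r1)
    (hτ0 : 0 ≤ τ) (hτ1 : τ ≤ 1) (k : Fin m) :
    negEntropy (fun j => ‖inner ℂ (etilde e t k) (edge e r0 r1 j)‖ ^ 2) =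
      quadMajorant (constCoef (m - 1) (edgeRatio m τ)) (sumCoef (m - 1) (edgeRatio m τ))
        fun j => inner ℂ (etilde e t k) (edge e r0 r1 j) :=
  negEntropy_eq_quadMajorant_of_forall_ne_eq_neg_smul (by simp)
    (edgeRatio_nonneg (natCast_sub_one_add_pos hm hτ0) hτ1)
    (inner_etilde_edge_eq_neg_smul e hm ht hτ0 k)

lemma negEntropy_inner_diffVec_edge (r0 r1 μ : ℝ) {r s : Fin m} (hrs : r ≠ s) :
    negEntropy (fun j => ‖inner ℂ (diffVec e r s) (edge e r0 r1 j)‖ ^ 2) =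
      quadMajorant (-log 2) μ fun j => inner ℂ (diffVec e r s) (edge e r0 r1 j) := by
  refine negEntropy_eq_quadMajorant_of_eq_neg μ hrs ?_ fun j hjr hjs => ?_
  · simp [inner_diffVec_edge, hrs, hrs.symm, neg_div]
  · simp [inner_diffVec_edge, hjr, hjs]

variable [FiniteDimensional ℂ H]

lemma isEquiprobablePure_pyramidEnsemble {r0 r1 : ℝ} (hm : 2 ≤ m) (h0 : 0 ≤ r0) (h1 : 0 ≤ r1)
    (hs : r0 + (m - 1) * r1 = 1) :
    IsEquiprobablePure (pyramidEnsemble e r0 r1 hm h0 h1 hs) (edge e r0 r1) where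
  prob_eq _ := by simp [pyramidEnsemble]
  state_eq _ := rfl

theorem isInfoOptimal_pyramidObservable {r0 r1 : ℝ} (hm : 2 ≤ m) (h0 : 0 ≤ r0) (h1 : 0 ≤ r1)
    (hs : r0 + (m - 1) * r1 = 1) {t τ : ℝ} (ht : 1 ≤ t) (hτ0 : 0 ≤ τ) (hτ1 : τ ≤ 1)
    (htτ : t * √r0 = τ * √r1) (hcoef : -log 2 ≤ constCoef (m - 1) (edgeRatio m τ))
    (hcoef' : t = 1 ∨ constCoef (m - 1) (edgeRatio m τ) = -log 2) :
    IsInfoOptimal (pyramidEnsemble e r0 r1 hm h0 h1 hs) (pyramidObservable e t) ∧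
      mutualInfo (pyramidEnsemble e r0 r1 hm h0 h1 hs) (pyramidObservable e t) =
        infoBound m (m * r0) (edgeRatio m τ) := by
  have hflat (h : (m - 1) * edgeRatio m τ = 1) : ∑ j, edge e r0 r1 j = 0 := by
    have hτ : 0 = τ :=
      hτ0.eq_or_lt.resolve_right fun hpos => (mul_edgeRatio_lt_one hm hpos).ne h
    rw [← hτ, zero_mul] at htτ
    rw [sum_edge, (mul_eq_zero_iff_left (by linarith)).1 htτ, mul_zero, Complex.ofReal_zero,
      zero_smul]
  have hσ : ‖∑ j, edge e r0 r1 j‖ ^ 2 / (m : ℝ) = m * r0 := by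
    rw [norm_sum_edge_sq e hm h0]
    field_simp
  rw [← hσ]
  refine (isEquiprobablePure_pyramidEnsemble e hm h0 h1 hs).isInfoOptimal_and_mutualInfo_eq
    (isObservable_pyramidObservable e (by omega) ht) (by simp) (Nat.ofNat_le_cast.2 hm)
    (edgeRatio_nonneg (natCast_sub_one_add_pos hm hτ0) hτ1) (mul_edgeRatio_le_one hm hτ0) hcoef
    hflat
    (a := Sum.elim (fun _ => (t ^ 2)⁻¹) fun _ => 2 / m * (1 - (t ^ 2)⁻¹))
    (v := Sum.elim (etilde e t) fun q => diffVec e q.1.1 q.1.2) ?_ ?_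
  · rintro (k | q) <;> rfl
  · rintro (k | q) ha
    · exact negEntropy_inner_etilde_edge e hm htτ hτ0 hτ1 k
    · rcases hcoef' with rfl | hcoef'
      · exact absurd (by simp) ha
      · rw [hcoef']
        exact negEntropy_inner_diffVec_edge e r0 r1 _ q.2.ne

theorem isInfoOptimal_flatObservable {r1 : ℝ} (hm : 2 ≤ m) (h1 : 0 ≤ r1)
    (hs : 0 + (m - 1) * r1 = 1) {β : ℝ} (hβ : 0 ≤ β) (hmβ : (m - 1) * β ≤ 1)
    (hcoef : constCoef (m - 1) β = -log 2) :
    IsInfoOptimal (pyramidEnsemble e 0 r1 hm le_rfl h1 hs) (flatObservable e) ∧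
      mutualInfo (pyramidEnsemble e 0 r1 hm le_rfl h1 hs) (flatObservable e) =
        infoBound m 0 β := by
  have hsum : ∑ j, edge e 0 r1 j = 0 := by simp [sum_edge]
  have hbound : infoBound m 0 β = infoBound m (‖∑ j, edge e 0 r1 j‖ ^ 2 / m) β := by simp [hsum]
  rw [hbound]
  refine (isEquiprobablePure_pyramidEnsemble e hm le_rfl h1 hs).isInfoOptimal_and_mutualInfo_eq
    (isObservable_flatObservable e (by omega)) (by simp) (Nat.ofNat_le_cast.2 hm)
    hβ hmβ hcoef.ge (fun _ => hsum) (a := fun k => k.elim 1 fun _ => 2 / m)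
    (v := fun k => k.elim (axis e) fun q => diffVec e q.1.1 q.1.2) ?_ ?_
  · rintro (_ | q)
    · simp [flatObservable]
    · rfl
  · rintro (_ | q) -
    · simp [inner_axis_edge e hm, negEntropy, quadMajorant]
    · rw [hcoef]
      exact negEntropy_inner_diffVec_edge e 0 r1 _ q.2.ne

end Pyramid

section EdgeCoefficients

variable {m : ℕ} {r0 r1 τ β : ℝ}

/-- The number `τ` with `√r₀ = τ √r₁`: it is `0` for the flat pyramid and `1` for the orthonormal
one. -/
def axisRatio (r0 r1 : ℝ) : ℝ := √r0 / √r1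

lemma axisRatio_nonneg (r0 r1 : ℝ) : 0 ≤ axisRatio r0 r1 := by
  rw [axisRatio]
  positivity

lemma axisRatio_le_one (hr : r0 ≤ r1) : axisRatio r0 r1 ≤ 1 :=
  div_le_one_of_le₀ (sqrt_le_sqrt hr) (sqrt_nonneg r1)

lemma axisRatio_mul_sqrt (hr1 : 0 < r1) : axisRatio r0 r1 * √r1 = √r0 :=
  div_mul_cancel₀ _ (sqrt_pos.2 hr1).ne'

lemma axisRatio_sq_mul (hr0 : 0 ≤ r0) (hr1 : 0 < r1) : axisRatio r0 r1 ^ 2 * r1 = r0 := by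
  rw [axisRatio, div_pow, sq_sqrt hr0, sq_sqrt hr1.le, div_mul_cancel₀ _ hr1.ne']

lemma pos_of_le_of_add_mul_eq_one (hr : r0 ≤ r1) (hs : r0 + (m - 1) * r1 = 1) :
    0 < r1 := by
  by_contra! hneg
  nlinarith

lemma coefA_eq (hm : m ≠ 0) (hr1 : 0 < r1) :
    coefA m r0 r1 = √r1 / √(m : ℝ) * (m - 1 + axisRatio r0 r1) := by
  have hsqrt : √(m : ℝ) ≠ 0 := (sqrt_pos.2 (by positivity)).ne'
  rw [coefA, ← axisRatio_mul_sqrt (r0 := r0) hr1, sqrt_mul m.cast_nonneg]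
  field_simp
  rw [sq_sqrt m.cast_nonneg]
  ring

lemma coefB_eq_neg_mul (hm : 2 ≤ m) (hr1 : 0 < r1) :
    coefB m r0 r1 = -(edgeRatio m (axisRatio r0 r1) * coefA m r0 r1) := by
  have hpos := natCast_sub_one_add_pos hm (axisRatio_nonneg r0 r1)
  rw [coefA_eq (by omega) hr1, coefB, edgeRatio, ← axisRatio_mul_sqrt (r0 := r0) hr1]
  field_simp
  ring

lemma coefA_sq_eq (hm : 2 ≤ m) (hr0 : 0 ≤ r0) (hr1 : 0 < r1) (hs : r0 + (m - 1) * r1 = 1) :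
    coefA m r0 r1 ^ 2 = (1 + (m - 1) * edgeRatio m (axisRatio r0 r1) ^ 2)⁻¹ := by
  have hpos := natCast_sub_one_add_pos hm (axisRatio_nonneg r0 r1)
  have hq := sub_one_add_sq_pos hm (axisRatio r0 r1)
  rw [coefA_eq (by omega) hr1, one_add_mul_edgeRatio_sq hpos, mul_pow, div_pow, sq_sqrt hr1.le,
    sq_sqrt m.cast_nonneg, inv_div]
  field_simp
  linear_combination axisRatio_sq_mul hr0 hr1 + hs

lemma natCast_mul_eq_coefA_sq_mul (hm : 2 ≤ m) (hr0 : 0 ≤ r0) (hr1 : 0 < r1) :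
    m * r0 = coefA m r0 r1 ^ 2 * (1 - (m - 1) * edgeRatio m (axisRatio r0 r1)) ^ 2 := by
  have hpos := natCast_sub_one_add_pos hm (axisRatio_nonneg r0 r1)
  rw [coefA_eq (by omega) hr1, one_sub_mul_edgeRatio hpos, mul_pow, div_pow, sq_sqrt hr1.le,
    sq_sqrt m.cast_nonneg]
  field_simp
  rw [mul_comm, axisRatio_sq_mul hr0 hr1]

lemma coefA_sq_mem_Icc (hm : 2 ≤ m) (hr0 : 0 ≤ r0) (hr1 : 0 < r1) (hr : r0 ≤ r1)
    (hs : r0 + (m - 1) * r1 = 1) : coefA m r0 r1 ^ 2 ∈ Set.Icc (((m : ℝ) - 1) / m) 1 := by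
  have hn := one_le_natCast_sub_one hm
  have hτ := axisRatio_nonneg r0 r1
  have hβ := edgeRatio_nonneg (natCast_sub_one_add_pos hm hτ) (axisRatio_le_one hr)
  have hle := mul_edgeRatio_le_one hm hτ
  have hsq : (((m : ℝ) - 1) * edgeRatio m (axisRatio r0 r1)) ^ 2 ≤ 1 :=
    pow_le_one₀ (mul_nonneg (by linarith) hβ) hle
  rw [coefA_sq_eq hm hr0 hr1 hs]
  refine ⟨?_, inv_le_one_of_one_le₀ (le_add_of_nonneg_right (by positivity))⟩
  rw [div_le_iff₀ (by linarith), ← div_eq_inv_mul, le_div_iff₀ (by positivity)]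
  nlinarith

lemma pObt_le_coefA_sq_iff (hm : 2 ≤ m) (hr0 : 0 ≤ r0) (hr1 : 0 < r1) (hr : r0 ≤ r1)
    (hs : r0 + (m - 1) * r1 = 1) :
    pObt m ≤ coefA m r0 r1 ^ 2 ↔ tauObt m ≤ axisRatio r0 r1 := by
  rw [pObt_eq hm, coefA_sq_eq hm hr0 hr1 hs, inv_one_add_mul_edgeRatio_sq_le_iff hm
    (sub_one_add_tauObt_pos hm) (natCast_sub_one_add_pos hm (axisRatio_nonneg r0 r1))
    (tauObt_lt_one hm).le (axisRatio_le_one hr)]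

lemma coefA_sq_le_pObt_iff (hm : 2 ≤ m) (hr0 : 0 ≤ r0) (hr1 : 0 < r1) (hr : r0 ≤ r1)
    (hs : r0 + (m - 1) * r1 = 1) :
    coefA m r0 r1 ^ 2 ≤ pObt m ↔ axisRatio r0 r1 ≤ tauObt m := by
  rw [pObt_eq hm, coefA_sq_eq hm hr0 hr1 hs, inv_one_add_mul_edgeRatio_sq_le_iff hm
    (natCast_sub_one_add_pos hm (axisRatio_nonneg r0 r1)) (sub_one_add_tauObt_pos hm)
    (axisRatio_le_one hr) (tauObt_lt_one hm).le]

lemma tauObt_pos_of_coefA_sq_le_pObt (hm : 2 ≤ m) (hr0 : 0 < r0) (hr : r0 ≤ r1)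
    (hs : r0 + (m - 1) * r1 = 1) (hp : coefA m r0 r1 ^ 2 ≤ pObt m) : 0 < tauObt m :=
  have hr1 := hr0.trans_le hr
  (div_pos (sqrt_pos.2 hr0) (sqrt_pos.2 hr1)).trans_le
    ((coefA_sq_le_pObt_iff hm hr0.le hr1 hr hs).1 hp)

lemma infoBound_edgeRatio_axisRatio (hm : 2 ≤ m) (hr0 : 0 ≤ r0) (hr1 : 0 < r1) (hr : r0 ≤ r1)
    (hs : r0 + (m - 1) * r1 = 1) :
    infoBound m (m * r0) (edgeRatio m (axisRatio r0 r1)) = srmInfo m r0 r1 := by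
  have hn : 0 ≤ (m : ℝ) - 1 := zero_le_one.trans (one_le_natCast_sub_one hm)
  have hβ0 := edgeRatio_nonneg (natCast_sub_one_add_pos hm (axisRatio_nonneg r0 r1))
    (axisRatio_le_one hr)
  rw [infoBound, srmInfo, natCast_mul_eq_coefA_sq_mul hm hr0 hr1, coefB_eq_neg_mul hm hr1, neg_sq,
    mul_pow, coefA_sq_eq hm hr0 hr1 hs]
  set β := edgeRatio m (axisRatio r0 r1)
  have hS : 0 < 1 + ((m : ℝ) - 1) * β ^ 2 := by positivity
  have hcoef := constCoef_mul_add_sumCoef_mul (n := (m : ℝ) - 1) hβ0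
  set S := 1 + ((m : ℝ) - 1) * β ^ 2
  have hlog : β ^ 2 * log (β ^ 2 / S) = β ^ 2 * (log (β ^ 2) - log S) := by
    rcases hβ0.eq_or_lt with hβ | hβ
    · simp [← hβ]
    · rw [log_div (by positivity) hS.ne']
  have hlog2 : log 2 ≠ 0 := (log_pos one_lt_two).ne'
  have hS1 : ((m : ℝ) - 1) * β ^ 2 = S - 1 := (add_sub_cancel_left _ _).symm
  simp only [logb, log_inv]
  field_simp
  linear_combination hcoef - (m - 1) * hlog - log S * hS1

lemma infoBound_edgeRatio_of_gObt_eq_zero (hm : 2 ≤ m) (h : 0 < (m : ℝ) - 1 + τ) (hτ : τ ≤ 1)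
    (hg : gObt m τ = 0) (σ : ℝ) :
    infoBound m σ (edgeRatio m τ) =
      logb 2 (m / 2) + sumCoef (m - 1) (edgeRatio m τ) * σ / log 2 := by
  have hlog2 : log 2 ≠ 0 := (log_pos one_lt_two).ne'
  rw [infoBound, constCoef_edgeRatio hm h hτ, hg, logb_div (by positivity) two_ne_zero,
    logb_self_eq_one one_lt_two]
  field_simp
  ring

lemma sumCoef_edgeRatio_of_gObt_eq_zero (hm : 2 ≤ m) (hτ0 : 0 < τ) (hτ1 : τ < 1)
    (hg : gObt m τ = 0) :
    sumCoef (m - 1) (edgeRatio m τ) * m =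
      -((τ⁻¹ - 1) * log (2 * (τ - 1) ^ 2 / (m * (m - 1 + τ ^ 2)))) := by
  have hm0 : (m : ℝ) ≠ 0 := by positivity
  have hq := sub_one_add_sq_pos hm τ
  have hsub : 1 - τ ≠ 0 := (sub_pos.2 hτ1).ne'
  have hlog2 : log 2 ≠ 0 := (log_pos one_lt_two).ne'
  have hquot : 2 * (τ - 1) ^ 2 / (m * (m - 1 + τ ^ 2)) =
      (1 - τ) ^ 2 / (m * (m - 1 + τ ^ 2) / 2) := by
    field_simp
    ring
  rw [sumCoef_edgeRatio hm hτ0 hτ1.le, hquot, log_div (by positivity) (by positivity)]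
  simp only [gObt, logb, log_pow] at hg ⊢
  push_cast at hg ⊢
  field_simp at hg ⊢
  linear_combination -hg

lemma muTilde0_inv_one_add_mul_sq (hm : 2 ≤ m) (hβ : 0 < β) :
    muTilde0 m (1 + (m - 1) * β ^ 2)⁻¹ = -(sumCoef (m - 1) β / log 2) := by
  have hn : 0 < (m : ℝ) - 1 := zero_lt_one.trans_le (one_le_natCast_sub_one hm)
  have hlog2 : log 2 ≠ 0 := (log_pos one_lt_two).ne'
  set S := 1 + ((m : ℝ) - 1) * β ^ 2 with hS
  have hS0 : 0 < S := by positivity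
  have hcompl : (1 - S⁻¹) / ((m : ℝ) - 1) = β ^ 2 / S := by
    field_simp
    rw [hS]
    ring
  have hprod : S⁻¹ * (1 - S⁻¹) / ((m : ℝ) - 1) = (β / S) ^ 2 := by
    rw [mul_div_assoc, hcompl]
    field_simp
  have hdenom : (((m : ℝ) - 1) * (β / √S) - (√S)⁻¹) * ((√S)⁻¹ + β / √S) =
      -((1 - (m - 1) * β) * (1 + β)) / S := by
    nth_rewrite 5 [← mul_self_sqrt hS0.le]
    field_simp
    ring
  rw [muTilde0, hprod, hcompl, sqrt_sq (by positivity), sqrt_div (by positivity), sqrt_sq hβ.le,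
    sqrt_inv, hdenom, logb, logb, log_inv, log_div (by positivity) hS0.ne', log_pow, sumCoef]
  field_simp
  push_cast
  ring

end EdgeCoefficients

/-! ### Optimal observables and accessible information -/

section Optimality

variable {m : ℕ} {H : Type*} [NormedAddCommGroup H] [InnerProductSpace ℂ H]
  [FiniteDimensional ℂ H] {r0 r1 : ℝ}

theorem isInfoOptimal_pyramidObservable_one (e : OrthonormalBasis (Fin m) ℂ H) (hm : 2 ≤ m)
    (hr0 : 0 ≤ r0) (hr : r0 ≤ r1) (hs : r0 + (m - 1) * r1 = 1)
    (hp : pObt m ≤ coefA m r0 r1 ^ 2) :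
    IsInfoOptimal (pyramidEnsemble e r0 r1 hm hr0 (hr0.trans hr) hs) (pyramidObservable e 1) ∧
      mutualInfo (pyramidEnsemble e r0 r1 hm hr0 (hr0.trans hr) hs) (pyramidObservable e 1) =
        srmInfo m r0 r1 := by
  have hr1 := pos_of_le_of_add_mul_eq_one hr hs
  have hτ0 := axisRatio_nonneg r0 r1
  have hτ1 := axisRatio_le_one hr
  have hg : gObt m (axisRatio r0 r1) ≤ 0 :=
    gObt_nonpos_of_tauObt_le hm ((pObt_le_coefA_sq_iff hm hr0 hr1 hr hs).1 hp) hτ1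
  rw [← infoBound_edgeRatio_axisRatio hm hr0 hr1 hr hs]
  refine isInfoOptimal_pyramidObservable e hm hr0 _ hs le_rfl hτ0 hτ1
    (by rw [one_mul, axisRatio_mul_sqrt hr1]) ?_ (Or.inl rfl)
  rw [constCoef_edgeRatio hm (natCast_sub_one_add_pos hm hτ0) hτ1]
  nlinarith [log_pos one_lt_two]

theorem isInfoOptimal_pyramidObservable_tauObt (e : OrthonormalBasis (Fin m) ℂ H) (hm : 2 ≤ m)
    (hr0 : 0 < r0) (hr : r0 ≤ r1) (hs : r0 + (m - 1) * r1 = 1)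
    (hp : coefA m r0 r1 ^ 2 ≤ pObt m) :
    1 ≤ √(r1 / r0) * tauObt m ∧
      IsInfoOptimal (pyramidEnsemble e r0 r1 hm hr0.le (hr0.le.trans hr) hs)
        (pyramidObservable e (√(r1 / r0) * tauObt m)) ∧
      mutualInfo (pyramidEnsemble e r0 r1 hm hr0.le (hr0.le.trans hr) hs)
        (pyramidObservable e (√(r1 / r0) * tauObt m)) =
          infoBound m (m * r0) (edgeRatio m (tauObt m)) := by
  have hr1 := hr0.trans_le hr
  have hsqrt0 : 0 < √r0 := sqrt_pos.2 hr0
  have hle : axisRatio r0 r1 ≤ tauObt m := (coefA_sq_le_pObt_iff hm hr0.le hr1 hr hs).1 hp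
  have hτ0 : 0 < tauObt m := tauObt_pos_of_coefA_sq_le_pObt hm hr0 hr hs hp
  have hcoef := constCoef_edgeRatio_tauObt hm
  have ht : 1 ≤ √(r1 / r0) * tauObt m := by
    rwa [sqrt_div hr1.le, ← inv_div, ← axisRatio, ← div_eq_inv_mul, one_le_div]
    exact div_pos hsqrt0 (sqrt_pos.2 hr1)
  refine ⟨ht, isInfoOptimal_pyramidObservable e hm hr0.le _ hs ht hτ0.le (tauObt_lt_one hm).le ?_
    hcoef.ge (Or.inr hcoef)⟩
  rw [sqrt_div hr1.le]
  field_simp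

theorem accessibleInfo_eq_of_coefA_sq_le_pObt (e : OrthonormalBasis (Fin m) ℂ H) (hm : 2 ≤ m)
    (hr0 : 0 ≤ r0) (hr : r0 ≤ r1) (hs : r0 + (m - 1) * r1 = 1)
    (hp : coefA m r0 r1 ^ 2 ≤ pObt m) :
    accessibleInfo (pyramidEnsemble e r0 r1 hm hr0 (hr0.trans hr) hs) =
      logb 2 (m / 2) + sumCoef (m - 1) (edgeRatio m (tauObt m)) * (m * r0) / log 2 := by
  have hτ := sub_one_add_tauObt_pos hm
  have hτ1 := (tauObt_lt_one hm).le
  rw [← infoBound_edgeRatio_of_gObt_eq_zero hm hτ hτ1 (gObt_tauObt hm)]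
  rcases hr0.eq_or_lt with rfl | hpos
  · have hτ0 : 0 ≤ tauObt m := (axisRatio_nonneg 0 r1).trans
      ((coefA_sq_le_pObt_iff hm le_rfl (pos_of_le_of_add_mul_eq_one hr hs) hr hs).1 hp)
    obtain ⟨hopt, hval⟩ := isInfoOptimal_flatObservable e hm hr hs (edgeRatio_nonneg hτ hτ1)
      (mul_edgeRatio_le_one hm hτ0) (constCoef_edgeRatio_tauObt hm)
    rw [hopt.accessibleInfo_eq, hval, mul_zero]
  · obtain ⟨-, hopt, hval⟩ := isInfoOptimal_pyramidObservable_tauObt e hm hpos hr hs hp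
    rw [hopt.accessibleInfo_eq, hval]

theorem accessibleInfo_eq_sub_logb_of_coefA_sq_le_pObt (e : OrthonormalBasis (Fin m) ℂ H)
    (hm : 2 ≤ m) (hr0 : 0 ≤ r0) (hr : r0 ≤ r1) (hs : r0 + (m - 1) * r1 = 1)
    (hp : coefA m r0 r1 ^ 2 ≤ pObt m) :
    accessibleInfo (pyramidEnsemble e r0 r1 hm hr0 (hr0.trans hr) hs) =
      logb 2 (m / 2) - r0 * ((tauObt m)⁻¹ - 1) *
        logb 2 (2 * (tauObt m - 1) ^ 2 / (m * (m - 1 + tauObt m ^ 2))) := by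
  rw [accessibleInfo_eq_of_coefA_sq_le_pObt e hm hr0 hr hs hp]
  rcases hr0.eq_or_lt with rfl | hpos
  · simp
  · have hτ0 := tauObt_pos_of_coefA_sq_le_pObt hm hpos hr hs hp
    have hcoef := sumCoef_edgeRatio_of_gObt_eq_zero hm hτ0 (tauObt_lt_one hm) (gObt_tauObt hm)
    rw [← mul_assoc, hcoef]
    simp only [logb]
    ring

theorem accessibleInfo_eq_sub_muTilde0_of_coefA_sq_le_pObt (e : OrthonormalBasis (Fin m) ℂ H)
    (hm : 2 ≤ m) (hr0 : 0 ≤ r0) (hr : r0 ≤ r1) (hs : r0 + (m - 1) * r1 = 1)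
    (hp : coefA m r0 r1 ^ 2 ≤ pObt m) :
    accessibleInfo (pyramidEnsemble e r0 r1 hm hr0 (hr0.trans hr) hs) =
      logb 2 (m / 2) - r0 * m * muTilde0 m (pObt m) := by
  rw [accessibleInfo_eq_of_coefA_sq_le_pObt e hm hr0 hr hs hp, pObt_eq hm,
    muTilde0_inv_one_add_mul_sq hm (edgeRatio_pos (sub_one_add_tauObt_pos hm) (tauObt_lt_one hm))]
  ring

end Optimality

end QPyramid

end

theorem corollary2 {H : Type*} [NormedAddCommGroup H] [InnerProductSpace ℂ H]
    [FiniteDimensional ℂ H] (m : ℕ) (hm : 2 ≤ m) (e : OrthonormalBasis (Fin m) ℂ H)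
    (r0 r1 : ℝ) (hr0 : 0 ≤ r0) (hr : r0 ≤ r1) (hsum : r0 + (m - 1) * r1 = 1) :
    let E := QPyramid.pyramidEnsemble e r0 r1 hm hr0 (hr0.trans hr) hsum
    let p := QPyramid.coefA m r0 r1 ^ 2
    -- the constants `τ_o(m)` and `p(m)` are well defined
    (IsGreatest {τ : ℝ | τ ≤ 1 ∧ QPyramid.gObt m τ = 0} (QPyramid.tauObt m) ∧
      (m ≤ 6 → {τ : ℝ | τ ∈ Set.Icc 0 1 ∧ QPyramid.gObt m τ = 0} = {QPyramid.tauObt m}) ∧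
      (7 ≤ m → QPyramid.tauObt m < 0 ∧ QPyramid.pObt m < ((m : ℝ) - 1) / m) ∧
      p ∈ Set.Icc (((m : ℝ) - 1) / m) 1) ∧
    -- the information-optimal observable
    ((7 ≤ m → QPyramid.IsInfoOptimal E (QPyramid.pyramidObservable e 1)) ∧
      (m ≤ 6 → QPyramid.pObt m ≤ p →
        QPyramid.IsInfoOptimal E (QPyramid.pyramidObservable e 1)) ∧
      (m ≤ 6 → 0 < r0 → p ≤ QPyramid.pObt m →
        1 ≤ √(r1 / r0) * QPyramid.tauObt m ∧
        QPyramid.IsInfoOptimal E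
          (QPyramid.pyramidObservable e (√(r1 / r0) * QPyramid.tauObt m)))) ∧
    -- the accessible information
    (BddAbove (QPyramid.infoValues E) ∧
      (p ∈ Set.Icc (max (((m : ℝ) - 1) / m) (QPyramid.pObt m)) 1 →
        QPyramid.accessibleInfo E = QPyramid.srmInfo m r0 r1) ∧
      (m ≤ 6 → p ∈ Set.Icc (((m : ℝ) - 1) / m) (QPyramid.pObt m) →
        QPyramid.accessibleInfo E = Real.logb 2 (m / 2) -
            r0 * ((QPyramid.tauObt m)⁻¹ - 1) *
              Real.logb 2 (2 * (QPyramid.tauObt m - 1) ^ 2 /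
                (m * (m - 1 + QPyramid.tauObt m ^ 2))) ∧
        QPyramid.accessibleInfo E = Real.logb 2 (m / 2) -
            r0 * m * QPyramid.muTilde0 m (QPyramid.pObt m))) := by
  intro E p
  have hp := QPyramid.coefA_sq_mem_Icc hm hr0 (QPyramid.pos_of_le_of_add_mul_eq_one hr hsum)
    hr hsum
  have hsteep := QPyramid.isInfoOptimal_pyramidObservable_one e hm hr0 hr hsum
  refine ⟨⟨QPyramid.isGreatest_tauObt hm, QPyramid.setOf_gObt_eq_zero hm,
    fun h => ⟨QPyramid.tauObt_neg h, QPyramid.pObt_lt h⟩, hp⟩,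
    ⟨fun h => (hsteep ((QPyramid.pObt_lt h).le.trans hp.1)).1, fun _ h => (hsteep h).1,
      fun _ hpos h => ?_⟩,
    (QPyramid.isEquiprobablePure_pyramidEnsemble e hm hr0 _ hsum).bddAbove_infoValues,
    fun h => ?_, fun _ h =>
      ⟨QPyramid.accessibleInfo_eq_sub_logb_of_coefA_sq_le_pObt e hm hr0 hr hsum h.2,
        QPyramid.accessibleInfo_eq_sub_muTilde0_of_coefA_sq_le_pObt e hm hr0 hr hsum h.2⟩⟩
  · obtain ⟨ht, hopt, -⟩ :=
      QPyramid.isInfoOptimal_pyramidObservable_tauObt e hm hpos hr hsum h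
    exact ⟨ht, hopt⟩
  · obtain ⟨hopt, hval⟩ := hsteep ((le_max_right _ _).trans h.1)
    exact hopt.accessibleInfo_eq.trans hval
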